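/- Let $k$ be a field; algebras are over $k$, associative and unital, and $\otimes=\otimes_k$. **Quasi-bialgebras.** Let $H$ be a quasi-bialgebra: an algebra with algebra maps $\Delta:H\to H\otimes H$, $\Delta(h)=h_1\otimes h_2$, and $\varepsilon:H\to k$, and an invertible $\Phi\in H\otimes H\otimes H$ such that $(\mathrm{id}\otimes\Delta)(\Delta(h))\,\Phi=\Phi\,(\Delta\otimes\mathrm{id})(\Delta(h))$ and $(\varepsilon\otimes\mathrm{id})\Delta(h)=h=(\mathrm{id}\otimes\varepsilon)\Delta(h)$ for all $h\in H$, $(1\otimes\Phi)(\mathrm{id}\otimes\Delta\otimes\mathrm{id})(\Phi)(\Phi\otimes1)=(\mathrm{id}\otimes\mathrm{id}\otimes\Delta)(\Phi)(\Delta\otimes\mathrm{id}\otimes\mathrm{id})(\Phi)$ and $(\mathrm{id}\otimes\varepsilon\otimes\mathrm{id})(\Phi)=1\otimes1$. Write $\Phi^{-1}=x^1\otimes x^2\otimes x^3$. Let $F=F^1\otimes F^2\in H\otimes H$ be a gauge transformation, i.e. invertible with $(\varepsilon\otimes\mathrm{id})(F)=(\mathrm{id}\otimes\varepsilon)(F)=1$,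 and write $F^{-1}=G^1\otimes G^2$. Let $H_F$ be the algebra $H$ with counit $\varepsilon$ and $$\Delta_F(h)=F\Delta(h)F^{-1},\qquad \Phi_F=(1\otimes F)(\mathrm{id}\otimes\Delta)(F)\,\Phi\,(\Delta\otimes\mathrm{id})(F^{-1})(F^{-1}\otimes1).$$ **Module algebras.** Let $B$ be a right $H$-module algebra: a right $H$-module with a bilinear multiplication that has a unit $1_B$, such that $(bb')\cdot h=(b\cdot h_1)(b'\cdot h_2)$, $1_B\cdot h=\varepsilon(h)1_B$ and $(bb')b''=(b\cdot x^1)\big((b'\cdot x^2)(b''\cdot x^3)\big)$. Let ${}_FB$ be the module $B$ with the same unit and the multiplication $b*b'=(b\cdot F^1)(b'\cdot F^2)$. The smash product $H\#B$ is the space $H\otimes B$ with unit $1\#1_B$ and multiplication $$(h\#b)(h'\#b')=hh'_1x^1\#(b\cdot h'_2x^2)(b'\cdot x^3);$$ $H_F\#{}_FB$ is defined by the same formula for $H_F$ and ${}_FB$. **Crossed products.** Let $A$ be an algebra with multiplication $\mu$, $V$ a vector space with a distinguished element $1_V$, and $R:V\otimes A\to A\otimes V$, $\sigma:V\otimes V\to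 A\otimes V$ linear maps. For a linear map $f:V\otimes X\to A\otimes V$ put $\hat f=(\mu\otimes\mathrm{id})(\mathrm{id}_A\otimes f):A\otimes V\otimes X\to A\otimes V$, and for $f:V\to A\otimes V$ put $\hat f=(\mu\otimes\mathrm{id})(\mathrm{id}_A\otimes f):A\otimes V\to A\otimes V$. One says that $A\otimes_{R,\sigma}V$ is a crossed product if $R(1_V\otimes a)=a\otimes1_V$, $R(v\otimes1_A)=1_A\otimes v$, $\sigma(1_V\otimes v)=\sigma(v\otimes1_V)=1_A\otimes v$ for all $a\in A$, $v\in V$, and $$R(\mathrm{id}\otimes\mu)=\hat R(R\otimes\mathrm{id}),\qquad \hat\sigma(R\otimes\mathrm{id})(\mathrm{id}\otimes\sigma)=\hat\sigma(\sigma\otimes\mathrm{id}),\qquad \hat\sigma(R\otimes\mathrm{id})(\mathrm{id}\otimes R)=\hat R(\sigma\otimes\mathrm{id}).$$ Its multiplication is $m_{R,\sigma}=\hat\sigma(\hat R\otimes\mathrm{id})$ on $(A\otimes V)\otimes(A\otimes V)$. For linear maps $\theta,\gamma:V\to A\otimes V$ put $R'=\hat\gamma\,\hat R\,(\theta\otimes\mathrm{id})$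 and $\sigma'=\hat\gamma\, m_{R,\sigma}(\theta\otimes\theta)$. The *twisting conditions* for $(\theta,\gamma)$ are: $\theta(1_V)=\gamma(1_V)=1_A\otimes1_V$; $\hat\gamma(\theta(v))=1_A\otimes v=\hat\theta(\gamma(v))$ for all $v\in V$; and $\widehat{\sigma'}\,(\hat\gamma R\otimes\mathrm{id})(\mathrm{id}\otimes\gamma)=\hat\gamma\,\sigma$. **Proposition.** With $H$, $F$, $B$ as above: 1. $H_F$ is a quasi-bialgebra and ${}_FB$ is a right $H_F$-module algebra, with the same unit and action as $B$. 2. $H\#B$ is the crossed product $H\otimes_{R,\sigma}B$ (with the same multiplication and distinguished element $1_B$), where $R(b\otimes h)=h_1\otimes b\cdot h_2$ and $\sigma(b\otimes b')=x^1\otimes(b\cdot x^2)(b'\cdot x^3)$. Likewise $H_F\#{}_FB$ is the crossed product $H\otimes_{R_F,\sigma_F}B$, where $R_F,\sigma_F$ are given by the same formulas for $H_F$ and ${}_FB$. 3. The maps $\theta(b)=F^1\otimes b\cdot F^2$ and $\gamma(b)=G^1\otimes b\cdot G^2$ satisfy the twisting conditions for $H\otimes_{R,\sigma}B$, and $R'=R_F$,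 $\sigma'=\sigma_F$. 4. $H\#B$ and $H_F\#{}_FB$ are associative algebras with unit $1\#1_B$, and there is an algebra isomorphism $$H_F\#{}_FB\;\cong\;H\#B,\qquad h\#b\mapsto hF^1\#b\cdot F^2,$$ which is the map $\hat\theta:h\otimes b\mapsto h\,\theta(b)$. -/

import Mathlib

open scoped TensorProduct

noncomputable section

namespace QuasiSmash

/-! ### Associative unital algebra structures on a vector space -/

section AlgebraStructures

variable {k M : Type*} [Field k] [AddCommGroup M] [Module k M]

/-- A bilinear multiplication `mul` and an element `one` of a vector space `M` make `M` an
associative unital `k`-algebra. -/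
structure IsAlgebraStructure (mul : M →ₗ[k] M →ₗ[k] M) (one : M) : Prop where
  mul_assoc : ∀ x y z, mul (mul x y) z = mul x (mul y z)
  one_mul : ∀ x, mul one x = x
  mul_one : ∀ x, mul x one = x

/-- The vector space `M` regarded as the `k`-algebra with multiplication `mul` and unit `one`. -/
def AlgebraOf {mul : M →ₗ[k] M →ₗ[k] M} {one : M} (_h : IsAlgebraStructure mul one) : Type _ := M

namespace AlgebraOf

variable {mul : M →ₗ[k] M →ₗ[k] M} {one : M} (h : IsAlgebraStructure mul one)

instance : AddCommGroup (AlgebraOf h) := inferInstanceAs (AddCommGroup M)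

instance : Module k (AlgebraOf h) := inferInstanceAs (Module k M)

/-- The identity map from the vector space `M` to the algebra `(M, mul, one)`. -/
def of : M ≃ₗ[k] AlgebraOf h := LinearEquiv.refl k M

instance : Ring (AlgebraOf h) where
  __ := (inferInstance : AddCommGroup (AlgebraOf h))
  mul x y := of h (mul ((of h).symm x) ((of h).symm y))
  one := of h one
  left_distrib x y z := (mul x).map_add y z
  right_distrib x y z := LinearMap.map_add₂ mul x y z
  zero_mul x := LinearMap.map_zero₂ mul x
  mul_zero x := (mul x).map_zero
  mul_assoc := h.mul_assoc
  one_mul := h.one_mul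
  mul_one := h.mul_one

instance : Algebra k (AlgebraOf h) :=
  Algebra.ofModule (fun r x y => LinearMap.map_smul₂ mul r x y) (fun r x y => (mul x).map_smul r y)

theorem of_mul_of (x y : M) : of h x * of h y = of h (mul x y) := rfl

theorem one_eq_of : (1 : AlgebraOf h) = of h one := rfl

end AlgebraOf

end AlgebraStructures

/-! ### Crossed products of an algebra with a vector space -/

section CrossedProducts

variable (k : Type*) {A V X : Type*} [Field k] [Ring A] [Algebra k A]
  [AddCommGroup V] [Module k V] [AddCommGroup X] [Module k X]

variable (A V) in
/-- `μ ⊗ id : A ⊗ A ⊗ V → A ⊗ V`. -/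
def mulId : A ⊗[k] (A ⊗[k] V) →ₗ[k] A ⊗[k] V :=
  (LinearMap.mul' k A).rTensor V ∘ₗ (TensorProduct.assoc k A A V).symm.toLinearMap

variable {k}

/-- For `f : V → A ⊗ V` the map `(μ ⊗ id) ∘ (id ⊗ f) : A ⊗ V → A ⊗ V`, `a ⊗ v ↦ a f(v)`. -/
def ext₁ (f : V →ₗ[k] A ⊗[k] V) : A ⊗[k] V →ₗ[k] A ⊗[k] V :=
  mulId k A V ∘ₗ f.lTensor A

/-- For `f : V ⊗ X → A ⊗ V` the map `(μ ⊗ id) ∘ (id ⊗ f) : (A ⊗ V) ⊗ X → A ⊗ V`,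
`a ⊗ v ⊗ x ↦ a f(v ⊗ x)`. -/
def ext₂ (f : V ⊗[k] X →ₗ[k] A ⊗[k] V) : (A ⊗[k] V) ⊗[k] X →ₗ[k] A ⊗[k] V :=
  mulId k A V ∘ₗ f.lTensor A ∘ₗ (TensorProduct.assoc k A V X).toLinearMap

/-- The conditions on `R : V ⊗ A → A ⊗ V` and `σ : V ⊗ V → A ⊗ V` under which
`A ⊗_{R, σ} V` is a crossed product, where `e` is the distinguished element of `V`. -/
structure IsCrossedProduct (e : V) (R : V ⊗[k] A →ₗ[k] A ⊗[k] V)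
    (σ : V ⊗[k] V →ₗ[k] A ⊗[k] V) : Prop where
  R_one_left : ∀ a : A, R (e ⊗ₜ a) = a ⊗ₜ e
  R_one_right : ∀ v : V, R (v ⊗ₜ 1) = 1 ⊗ₜ v
  σ_one_left : ∀ v : V, σ (e ⊗ₜ v) = 1 ⊗ₜ v
  σ_one_right : ∀ v : V, σ (v ⊗ₜ e) = 1 ⊗ₜ v
  R_mul : R ∘ₗ (LinearMap.mul' k A).lTensor V =
    ext₂ R ∘ₗ R.rTensor A ∘ₗ (TensorProduct.assoc k V A A).symm.toLinearMap
  σ_cocycle :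
    ext₂ σ ∘ₗ R.rTensor V ∘ₗ (TensorProduct.assoc k V A V).symm.toLinearMap ∘ₗ σ.lTensor V =
      ext₂ σ ∘ₗ σ.rTensor V ∘ₗ (TensorProduct.assoc k V V V).symm.toLinearMap
  twisted_module :
    ext₂ σ ∘ₗ R.rTensor V ∘ₗ (TensorProduct.assoc k V A V).symm.toLinearMap ∘ₗ R.lTensor V =
      ext₂ R ∘ₗ σ.rTensor A ∘ₗ (TensorProduct.assoc k V V A).symm.toLinearMap

/-- The multiplication of `A ⊗_{R, σ} V`, as a map on `(A ⊗ V) ⊗ (A ⊗ V)`: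
`(a ⊗ v)(a' ⊗ v') = a a'_R σ₁(v_R, v') ⊗ σ₂(v_R, v')`. -/
def crossedMulMap (R : V ⊗[k] A →ₗ[k] A ⊗[k] V) (σ : V ⊗[k] V →ₗ[k] A ⊗[k] V) :
    (A ⊗[k] V) ⊗[k] (A ⊗[k] V) →ₗ[k] A ⊗[k] V :=
  ext₂ σ ∘ₗ (ext₂ R).rTensor V ∘ₗ (TensorProduct.assoc k (A ⊗[k] V) A V).symm.toLinearMap

/-- The multiplication of `A ⊗_{R, σ} V`, as a bilinear map. -/
def crossedMul (R : V ⊗[k] A →ₗ[k] A ⊗[k] V) (σ : V ⊗[k] V →ₗ[k] A ⊗[k] V) :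
    A ⊗[k] V →ₗ[k] A ⊗[k] V →ₗ[k] A ⊗[k] V :=
  TensorProduct.curry (crossedMulMap R σ)

/-- The map `R'(v ⊗ a) = v_{<-1>} a_R v_{<0>R{-1}} ⊗ v_{<0>R{0}}` built from `R`,
`θ(v) = v_{<-1>} ⊗ v_{<0>}` and `γ(v) = v_{{-1}} ⊗ v_{{0}}`. -/
def twistedR (R : V ⊗[k] A →ₗ[k] A ⊗[k] V) (θ γ : V →ₗ[k] A ⊗[k] V) :
    V ⊗[k] A →ₗ[k] A ⊗[k] V :=
  ext₁ γ ∘ₗ ext₂ R ∘ₗ θ.rTensor A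

/-- The map `σ'`: multiply `θ(v)` and `θ(w)` in `A ⊗_{R, σ} V`, then apply
`a ⊗ u ↦ a γ(u)`. -/
def twistedσ (R : V ⊗[k] A →ₗ[k] A ⊗[k] V) (σ : V ⊗[k] V →ₗ[k] A ⊗[k] V)
    (θ γ : V →ₗ[k] A ⊗[k] V) : V ⊗[k] V →ₗ[k] A ⊗[k] V :=
  ext₁ γ ∘ₗ crossedMulMap R σ ∘ₗ TensorProduct.map θ θ

/-- The conditions on `θ` and `γ`, for a crossed product `A ⊗_{R, σ} V`, in the theorem of
invariance under twisting. Note that `ext₁ θ` is `a ⊗ v ↦ a v_{<-1>} ⊗ v_{<0>}` and `ext₁ γ` is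
`a ⊗ v ↦ a v_{{-1}} ⊗ v_{{0}}`. -/
structure IsTwistingPair (e : V) (R : V ⊗[k] A →ₗ[k] A ⊗[k] V)
    (σ : V ⊗[k] V →ₗ[k] A ⊗[k] V) (θ γ : V →ₗ[k] A ⊗[k] V) : Prop where
  θ_one : θ e = 1 ⊗ₜ e
  γ_one : γ e = 1 ⊗ₜ e
  ext_γ_θ : ∀ v : V, ext₁ γ (θ v) = 1 ⊗ₜ v
  ext_θ_γ : ∀ v : V, ext₁ θ (γ v) = 1 ⊗ₜ v
  compat :
    ext₂ (twistedσ R σ θ γ) ∘ₗ (ext₁ γ ∘ₗ R).rTensor V ∘ₗ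
        (TensorProduct.assoc k V A V).symm.toLinearMap ∘ₗ γ.lTensor V =
      ext₁ γ ∘ₗ σ

end CrossedProducts

/-! ### Quasi-bialgebras and gauge transformations -/

section QuasiBialgebras

variable (k H : Type*) [Field k] [Ring H] [Algebra k H]

/-- The structure maps of a quasi-bialgebra on the algebra `H`: a comultiplication and a counit,
which are algebra maps, and an invertible element `Φ` of `H ⊗ H ⊗ H`. The axioms are stated in
`IsQuasiBialgebra`. -/
structure QuasiBialgebraData where
  /-- the comultiplication `Δ` -/
  Δ : H →ₐ[k] H ⊗[k] H
  /-- the counit `ε` -/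
  ε : H →ₐ[k] k
  /-- the associator `Φ` -/
  Φ : (H ⊗[k] (H ⊗[k] H))ˣ

variable {k H}

/-- `f ⊗ id : H ⊗ X → (H ⊗ H) ⊗ X = H ⊗ (H ⊗ X)` for an algebra map `f : H → H ⊗ H`. -/
def coLeft (X : Type*) [Semiring X] [Algebra k X] (f : H →ₐ[k] H ⊗[k] H) :
    H ⊗[k] X →ₐ[k] H ⊗[k] (H ⊗[k] X) :=
  (Algebra.TensorProduct.assoc k k k H H X).toAlgHom.comp
    (Algebra.TensorProduct.map f (AlgHom.id k X))

/-- `id ⊗ f` for an algebra map `f`. -/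
def coRight {X Y : Type*} [Semiring X] [Algebra k X] [Semiring Y] [Algebra k Y] (f : X →ₐ[k] Y) :
    H ⊗[k] X →ₐ[k] H ⊗[k] Y :=
  Algebra.TensorProduct.map (AlgHom.id k H) f

/-- `x ↦ 1 ⊗ x`. -/
def oneTensor {X : Type*} [Semiring X] [Algebra k X] : X →ₐ[k] H ⊗[k] X :=
  Algebra.TensorProduct.includeRight

/-- `x ↦ x ⊗ 1`, from `H ⊗ H` to `H ⊗ H ⊗ H`. -/
def tensorOne₂ : H ⊗[k] H →ₐ[k] H ⊗[k] (H ⊗[k] H) :=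
  coRight Algebra.TensorProduct.includeLeft

/-- `x ↦ x ⊗ 1`, from `H ⊗ H ⊗ H` to `H ⊗ H ⊗ H ⊗ H`. -/
def tensorOne₃ : H ⊗[k] (H ⊗[k] H) →ₐ[k] H ⊗[k] (H ⊗[k] (H ⊗[k] H)) :=
  coRight tensorOne₂

theorem coLeft_tmul {X : Type*} [Semiring X] [Algebra k X] (f : H →ₐ[k] H ⊗[k] H) (h : H) (x : X) :
    coLeft X f (h ⊗ₜ x) = TensorProduct.assoc k H H X (f h ⊗ₜ x) := rfl

theorem tensorOne₂_tmul (g h : H) :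
    tensorOne₂ (g ⊗ₜ[k] h) = g ⊗ₜ[k] (h ⊗ₜ[k] (1 : H)) := rfl

theorem tensorOne₃_tmul (f g h : H) :
    tensorOne₃ (f ⊗ₜ[k] (g ⊗ₜ[k] h)) = f ⊗ₜ[k] (g ⊗ₜ[k] (h ⊗ₜ[k] (1 : H))) := rfl

namespace QuasiBialgebraData

variable (Q : QuasiBialgebraData k H)

/-- The axioms of a quasi-bialgebra. -/
structure IsQuasiBialgebra : Prop where
  /-- `(id ⊗ Δ)(Δ(h)) Φ = Φ (Δ ⊗ id)(Δ(h))` -/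
  quasi_coassoc : ∀ h : H, coRight Q.Δ (Q.Δ h) * Q.Φ = Q.Φ * coLeft H Q.Δ (Q.Δ h)
  /-- `(ε ⊗ id) ∘ Δ = id` -/
  counit_left : ∀ h : H,
    Algebra.TensorProduct.lid k H (Algebra.TensorProduct.map Q.ε (AlgHom.id k H) (Q.Δ h)) = h
  /-- `(id ⊗ ε) ∘ Δ = id` -/
  counit_right : ∀ h : H,
    Algebra.TensorProduct.rid k k H (Algebra.TensorProduct.map (AlgHom.id k H) Q.ε (Q.Δ h)) = h
  /-- `(1 ⊗ Φ)(id ⊗ Δ ⊗ id)(Φ)(Φ ⊗ 1) = (id ⊗ id ⊗ Δ)(Φ)(Δ ⊗ id ⊗ id)(Φ)` -/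
  pentagon :
    oneTensor (k := k) (H := H) (Q.Φ : H ⊗[k] (H ⊗[k] H)) * coRight (coLeft H Q.Δ) Q.Φ *
        tensorOne₃ Q.Φ =
      coRight (coRight Q.Δ) (Q.Φ : H ⊗[k] (H ⊗[k] H)) * coLeft (H ⊗[k] H) Q.Δ Q.Φ
  /-- `(id ⊗ ε ⊗ id)(Φ) = 1 ⊗ 1` -/
  counit_Φ :
    coRight ((Algebra.TensorProduct.lid k H).toAlgHom.comp
      (Algebra.TensorProduct.map Q.ε (AlgHom.id k H))) (Q.Φ : H ⊗[k] (H ⊗[k] H)) = 1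

/-- A gauge transformation: an invertible `F ∈ H ⊗ H` with `(ε ⊗ id)(F) = (id ⊗ ε)(F) = 1`. -/
structure IsGauge (F : (H ⊗[k] H)ˣ) : Prop where
  counit_left :
    Algebra.TensorProduct.lid k H (Algebra.TensorProduct.map Q.ε (AlgHom.id k H) F) = 1
  counit_right :
    Algebra.TensorProduct.rid k k H (Algebra.TensorProduct.map (AlgHom.id k H) Q.ε F) = 1

/-- The Drinfeld twist `H_F`: same algebra and counit, `Δ_F(h) = F Δ(h) F⁻¹` and
`Φ_F = (1 ⊗ F) (id ⊗ Δ)(F) Φ (Δ ⊗ id)(F⁻¹) (F⁻¹ ⊗ 1)`. -/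
def twist (F : (H ⊗[k] H)ˣ) : QuasiBialgebraData k H where
  Δ :=
    { toFun := fun h => F * Q.Δ h * (F⁻¹ : (H ⊗[k] H)ˣ)
      map_one' := by simp
      map_mul' := fun g h => by simp [mul_assoc]
      map_zero' := by simp
      map_add' := fun g h => by simp [mul_add, add_mul]
      commutes' := fun r => by
        rw [Q.Δ.commutes, ← Algebra.commutes, mul_assoc, Units.mul_inv, mul_one] }
  ε := Q.ε
  Φ := Units.map (oneTensor (k := k) (H := H) (X := H ⊗[k] H) : _ →* _) F *
    Units.map (coRight (H := H) Q.Δ : _ →* _) F * Q.Φ *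
    Units.map (coLeft H Q.Δ : _ →* _) F⁻¹ * Units.map (tensorOne₂ (k := k) (H := H) : _ →* _) F⁻¹

end QuasiBialgebraData

end QuasiBialgebras

/-! ### Right module algebras and smash products -/

section ModuleAlgebras

variable (k H B : Type*) [Field k] [Ring H] [Algebra k H] [AddCommGroup B] [Module k B]

/-- The structure maps of a right `H`-module algebra on the vector space `B`: an action
`b · h = act b h`, a multiplication (not necessarily associative) and a unit element. The axioms
are stated in `IsModuleAlgebra`. -/
structure ModuleAlgebraData where
  /-- the right action `b · h` -/
  act : B →ₗ[k] H →ₗ[k] B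
  /-- the multiplication -/
  mul : B →ₗ[k] B →ₗ[k] B
  /-- the unit -/
  one : B

variable {k H B}

namespace ModuleAlgebraData

variable (D : ModuleAlgebraData k H B)

/-- `T¹ ⊗ T² ↦ (b · T¹)(b' · T²)`, bilinear in `b` and `b'`. -/
def mulAct : B →ₗ[k] B →ₗ[k] H ⊗[k] H →ₗ[k] B :=
  LinearMap.mk₂ k (fun b b' => TensorProduct.lift D.mul ∘ₗ TensorProduct.map (D.act b) (D.act b'))
    (fun _ _ _ => by ext; simp) (fun _ _ _ => by ext; simp)
    (fun _ _ _ => by ext; simp) (fun _ _ _ => by ext; simp)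

theorem mulAct_tmul (b b' : B) (g h : H) :
    D.mulAct b b' (g ⊗ₜ h) = D.mul (D.act b g) (D.act b' h) := rfl

/-- `T¹ ⊗ T² ⊗ T³ ↦ (b · T¹)((b' · T²)(b'' · T³))`. -/
def mulAct₃ (b b' b'' : B) : H ⊗[k] (H ⊗[k] H) →ₗ[k] B :=
  TensorProduct.lift D.mul ∘ₗ TensorProduct.map (D.act b) (D.mulAct b' b'')

theorem mulAct₃_tmul (b b' b'' : B) (f g h : H) :
    D.mulAct₃ b b' b'' (f ⊗ₜ (g ⊗ₜ h)) =
      D.mul (D.act b f) (D.mul (D.act b' g) (D.act b'' h)) := rfl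

/-- The axioms of a right module algebra over the quasi-bialgebra `H`, that is, of an algebra in
the monoidal category of right `H`-modules: `B` is a right `H`-module with a unit
`1_B` of the multiplication, the multiplication and the unit are `H`-linear, and
`(b b') b'' = (b · x¹)((b' · x²)(b'' · x³))` where `Φ⁻¹ = x¹ ⊗ x² ⊗ x³`. -/
structure IsModuleAlgebra (Q : QuasiBialgebraData k H) : Prop where
  act_one : ∀ b : B, D.act b 1 = b
  act_mul : ∀ (b : B) (g h : H), D.act b (g * h) = D.act (D.act b g) h
  one_mul : ∀ b : B, D.mul D.one b = b
  mul_one : ∀ b : B, D.mul b D.one = b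
  mul_act : ∀ (b b' : B) (h : H), D.act (D.mul b b') h = D.mulAct b b' (Q.Δ h)
  one_act : ∀ h : H, D.act D.one h = Q.ε h • D.one
  quasi_assoc : ∀ b b' b'' : B,
    D.mul (D.mul b b') b'' = D.mulAct₃ b b' b'' ((Q.Φ⁻¹ : (H ⊗[k] (H ⊗[k] H))ˣ) : _)

/-- `_F B`: same space, action and unit as `B`, with the multiplication
`b * b' = (b · F¹)(b' · F²)`. -/
def twist (F : H ⊗[k] H) : ModuleAlgebraData k H B where
  act := D.act
  mul := D.mulAct.compr₂ (LinearMap.applyₗ F)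
  one := D.one

theorem twist_mul (F : H ⊗[k] H) (b b' : B) : (D.twist F).mul b b' = D.mulAct b b' F := rfl

/-- `b ↦ T¹ ⊗ b · T²` for `T ∈ H ⊗ H`. -/
def legAct (T : H ⊗[k] H) : B →ₗ[k] H ⊗[k] B :=
  LinearMap.applyₗ T ∘ₗ LinearMap.lTensorHom H ∘ₗ D.act

theorem legAct_tmul (g h : H) (b : B) : D.legAct (g ⊗ₜ h) b = g ⊗ₜ D.act b h := rfl

/-- `R : B ⊗ H → H ⊗ B`, `R(b ⊗ h) = h₁ ⊗ b · h₂`. -/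
def smashR (Q : QuasiBialgebraData k H) : B ⊗[k] H →ₗ[k] H ⊗[k] B :=
  TensorProduct.lift ((LinearMap.lTensorHom H ∘ₗ D.act).compl₂ Q.Δ.toLinearMap)

theorem smashR_tmul (Q : QuasiBialgebraData k H) (b : B) (h : H) :
    D.smashR Q (b ⊗ₜ h) = D.legAct (Q.Δ h) b := rfl

/-- `σ : B ⊗ B → H ⊗ B`, `σ(b, b') = x¹ ⊗ (b · x²)(b' · x³)`, where `Φ⁻¹ = x¹ ⊗ x² ⊗ x³`. -/
def smashσ (Q : QuasiBialgebraData k H) : B ⊗[k] B →ₗ[k] H ⊗[k] B :=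
  TensorProduct.lift (D.mulAct.compr₂ (LinearMap.applyₗ
    ((Q.Φ⁻¹ : (H ⊗[k] (H ⊗[k] H))ˣ) : H ⊗[k] (H ⊗[k] H)) ∘ₗ LinearMap.lTensorHom H))

theorem smashσ_tmul (Q : QuasiBialgebraData k H) (b b' : B) :
    D.smashσ Q (b ⊗ₜ b') =
      (D.mulAct b b').lTensor H ((Q.Φ⁻¹ : (H ⊗[k] (H ⊗[k] H))ˣ) : H ⊗[k] (H ⊗[k] H)) := rfl

/-- The element `h h'₁ x¹ ⊗ h'₂ x² ⊗ x³` of `H ⊗ H ⊗ H`, bilinear in `h` and `h'`, where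
`Φ⁻¹ = x¹ ⊗ x² ⊗ x³`. -/
def smashElement (Q : QuasiBialgebraData k H) : H →ₗ[k] H →ₗ[k] H ⊗[k] (H ⊗[k] H) :=
  LinearMap.mk₂ k
    (fun h h' => (h ⊗ₜ[k] (1 : H ⊗[k] H)) * tensorOne₂ (Q.Δ h') *
      ((Q.Φ⁻¹ : (H ⊗[k] (H ⊗[k] H))ˣ) : H ⊗[k] (H ⊗[k] H)))
    (fun _ _ _ => by simp only [TensorProduct.add_tmul, add_mul])
    (fun _ _ _ => by simp only [← TensorProduct.smul_tmul', smul_mul_assoc])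
    (fun _ _ _ => by simp only [map_add, mul_add, add_mul])
    (fun _ _ _ => by simp only [map_smul, mul_smul_comm, smul_mul_assoc])

/-- The multiplication of the smash product `H # B`:
`(h # b)(h' # b') = h h'₁ x¹ # (b · h'₂ x²)(b' · x³)`, where `Φ⁻¹ = x¹ ⊗ x² ⊗ x³`. -/
def smashMul (Q : QuasiBialgebraData k H) : H ⊗[k] B →ₗ[k] H ⊗[k] B →ₗ[k] H ⊗[k] B :=
  TensorProduct.curry
    (TensorProduct.lift
      ((LinearMap.lTensorHom H ∘ₗ TensorProduct.lift D.mulAct).flip ∘ₗ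
        TensorProduct.lift (smashElement Q))
      ∘ₗ (TensorProduct.tensorTensorTensorComm k H B H B).toLinearMap)

theorem smashMul_tmul (Q : QuasiBialgebraData k H) (h h' : H) (b b' : B) :
    D.smashMul Q (h ⊗ₜ b) (h' ⊗ₜ b') =
      (D.mulAct b b').lTensor H ((h ⊗ₜ[k] (1 : H ⊗[k] H)) * tensorOne₂ (Q.Δ h') *
        ((Q.Φ⁻¹ : (H ⊗[k] (H ⊗[k] H))ˣ) : H ⊗[k] (H ⊗[k] H))) := rfl

end ModuleAlgebraData

end ModuleAlgebras

end QuasiSmash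

end

noncomputable section

namespace QuasiSmash

/-! ### Slot-moving maps between tensor powers of `H`. -/

section Tensors

variable {k H X Y Z : Type*} [Field k] [Ring H] [Algebra k H] [Ring X] [Algebra k X]
  [Ring Y] [Algebra k Y] [Ring Z] [Algebra k Z]

/-! Elements of `B` are kept as parameters and everything else is pushed into tensor powers of `H`.
An element of `H ⊗ B` is written as `legAct T b` with `T ∈ H^{⊗2}`, as `(mulAct b b').lTensor H T`
with `T ∈ H^{⊗3}`, or as `(mulAct₃ b b' b'').lTensor H T` with `T ∈ H^{⊗4}`. Since the action is a
right action, each structure map becomes a product of such tensors. Because `T` is arbitrary, these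
translations follow by linearity from pure tensors. The central one is `crossedMulMap_legAct`: the
product of `legAct T b` and `legAct S b'` has tensor `(T ⊗ 1)(Δ ⊗ id)(S) Φ⁻¹`.

After translation, multiplicativity of `R` is multiplicativity of `Δ`, the cocycle condition is the
inverse pentagon, and the twisted module condition is quasi-coassociativity. Associativity of the
smash product uses the last two. Unit conditions use the counits of `Φ⁻¹`, including `(id ⊗ id ⊗
ε)(Φ) = 1`, which is extracted from the pentagon.

Twisting only inserts and cancels copies of `F`. In `Φ_F⁻¹ = (F ⊗ 1)(Δ ⊗ id)(F) Φ⁻¹ (id ⊗ Δ)(F⁻¹)(1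
⊗ F⁻¹)` the last factor is absorbed by the twisted multiplication of `B`, and the remaining ones are
exactly those produced by `θ` and `γ`. The isomorphism is right multiplication of tensors by `F`,
with inverse given by `F⁻¹`; its multiplicativity is checked by the same cancellation. The pentagon
for `Φ_F` is a computation in the group of units of `H^{⊗4}`, isolated in `pentagon_of_conj`. -/

theorem coRight_tmul (f : X →ₐ[k] Y) (h : H) (x : X) : coRight f (h ⊗ₜ[k] x) = h ⊗ₜ f x := rfl

theorem oneTensor_apply (x : X) : oneTensor (k := k) (H := H) x = 1 ⊗ₜ x := rfl

theorem coRight_coRight (f : X →ₐ[k] Y) (g : Y →ₐ[k] Z) (x : H ⊗[k] X) :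
    coRight g (coRight f x) = coRight (g.comp f) x := by
  induction x with
  | zero => simp
  | add x y hx hy => simp only [map_add, hx, hy]
  | tmul a b => rfl

theorem coRight_oneTensor (f : X →ₐ[k] Y) (x : X) :
    coRight f (oneTensor (H := H) x) = oneTensor (f x) := rfl

theorem coLeft_oneTensor (f : H →ₐ[k] H ⊗[k] H) (x : X) :
    coLeft X f (oneTensor x) = oneTensor (oneTensor x) := by
  simp only [oneTensor_apply, coLeft_tmul, map_one, Algebra.TensorProduct.one_def,
    TensorProduct.assoc_tmul]

theorem tensorOne₂_eq (x : H ⊗[k] H) :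
    tensorOne₂ x = TensorProduct.assoc k H H H (x ⊗ₜ 1) := by
  induction x with
  | zero => simp
  | add x y hx hy => simp only [map_add, TensorProduct.add_tmul, hx, hy]
  | tmul a b => rfl

/-- `(f ⊗ id)(h ⊗ x)` is the product of `f(h) ⊗ 1` and `1 ⊗ 1 ⊗ x`. -/
theorem coLeft_eq_mul (f : H →ₐ[k] H ⊗[k] H) (h : H) (x : X) :
    coLeft X f (h ⊗ₜ x) =
      coRight Algebra.TensorProduct.includeLeft (f h) * oneTensor (oneTensor x) := by
  rw [coLeft_tmul]
  generalize f h = t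
  induction t with
  | zero => simp
  | add x y hx hy => simp only [map_add, TensorProduct.add_tmul, hx, hy, add_mul]
  | tmul a b => simp [coRight_tmul, oneTensor_apply]

/-- The two factors occupy disjoint tensor slots. This reorders the factors produced by
`coLeft_eq_mul`. -/
theorem commute_coRight_oneTensor (t : H ⊗[k] H) (x : X) :
    Commute (coRight (Algebra.TensorProduct.includeLeft : H →ₐ[k] H ⊗[k] X) t)
      (oneTensor (oneTensor x)) := by
  induction t with
  | zero => simp
  | add x y hx hy => simp only [map_add]; exact hx.add_left hy
  | tmul a b => simp [coRight_tmul, oneTensor_apply, commute_iff_eq]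

theorem coLeft_coRight (f : H →ₐ[k] H ⊗[k] H) (g : X →ₐ[k] Y) (x : H ⊗[k] X) :
    coLeft Y f (coRight g x) = coRight (coRight g) (coLeft X f x) := by
  induction x with
  | zero => simp
  | add x y hx hy => simp only [map_add, hx, hy]
  | tmul a b =>
    rw [coRight_tmul, coLeft_tmul, coLeft_tmul]
    generalize f a = t
    induction t with
    | zero => simp
    | add x y hx hy => simp only [map_add, TensorProduct.add_tmul, hx, hy]
    | tmul a b => rfl

end Tensors

/-! ### Evaluating tensors over `H` on elements of `B`. -/

section Evaluation

variable {k H B : Type*} [Field k] [Ring H] [Algebra k H] [AddCommGroup B] [Module k B]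
  {Q : QuasiBialgebraData k H} {D : ModuleAlgebraData k H B}

theorem mulId_tmul {A V : Type*} [Ring A] [Algebra k A] [AddCommGroup V] [Module k V]
    (a a' : A) (v : V) : mulId k A V (a ⊗ₜ (a' ⊗ₜ v)) = (a * a') ⊗ₜ v := rfl

namespace ModuleAlgebraData

theorem mulId_legAct (a : H) (b : B) (T : H ⊗[k] H) :
    mulId k H B (a ⊗ₜ D.legAct T b) = D.legAct ((a ⊗ₜ 1) * T) b := by
  induction T with
  | zero => simp [legAct]
  | add x y hx hy =>
    simp only [legAct, map_add, LinearMap.add_apply, LinearMap.coe_comp, Function.comp_apply,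
      LinearMap.applyₗ_apply_apply, TensorProduct.tmul_add, mul_add] at *
    rw [hx, hy]
  | tmul g h => simp [legAct_tmul, mulId_tmul]

theorem legAct_add (S T : H ⊗[k] H) (b : B) :
    D.legAct (S + T) b = D.legAct S b + D.legAct T b := by simp [legAct]

theorem legAct_zero (b : B) : D.legAct (0 : H ⊗[k] H) b = 0 := by simp [legAct]

theorem mulId_lTensor {M : Type*} [Ring M] [Algebra k M] (f : M →ₗ[k] B) (a : H)
    (T : H ⊗[k] M) :
    mulId k H B (a ⊗ₜ f.lTensor H T) = f.lTensor H ((a ⊗ₜ 1) * T) := by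
  induction T with
  | zero => simp
  | add x y hx hy => simp only [map_add, TensorProduct.tmul_add, mul_add, hx, hy]
  | tmul g h => simp [mulId_tmul]

end ModuleAlgebraData

namespace ModuleAlgebraData.IsModuleAlgebra

variable (hD : D.IsModuleAlgebra Q)
include hD

/-- For a right action, what acts first stands on the left, so `h` multiplies the second leg of `T`
from the left. -/
theorem legAct_act (b : B) (h : H) (T : H ⊗[k] H) :
    D.legAct T (D.act b h) = D.legAct ((1 ⊗ₜ h) * T) b := by
  induction T with
  | zero => simp [legAct_zero]
  | add x y hx hy => simp only [legAct_add, mul_add, hx, hy]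
  | tmul g h => simp [legAct_tmul, hD.act_mul]

theorem mulAct_act (b b' : B) (g h : H) (T : H ⊗[k] H) :
    D.mulAct (D.act b g) (D.act b' h) T = D.mulAct b b' ((g ⊗ₜ h) * T) := by
  induction T with
  | zero => simp
  | add x y hx hy => simp only [map_add, mul_add, hx, hy]
  | tmul g h => simp [mulAct_tmul, hD.act_mul]

theorem act_mulAct (b b' : B) (T : H ⊗[k] H) (h : H) :
    D.act (D.mulAct b b' T) h = D.mulAct b b' (T * Q.Δ h) := by
  induction T with
  | zero => simp
  | add x y hx hy => simp only [map_add, add_mul, LinearMap.add_apply, hx, hy]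
  | tmul g g' => rw [mulAct_tmul, hD.mul_act, hD.mulAct_act]

theorem mulAct₃_act (b b' b'' : B) (f g h : H) (T : H ⊗[k] (H ⊗[k] H)) :
    D.mulAct₃ (D.act b f) (D.act b' g) (D.act b'' h) T =
      D.mulAct₃ b b' b'' ((f ⊗ₜ (g ⊗ₜ h)) * T) := by
  induction T with
  | zero => simp
  | add x y hx hy => simp only [map_add, mul_add, hx, hy]
  | tmul a T =>
    simp only [mulAct₃, LinearMap.comp_apply, TensorProduct.map_tmul, TensorProduct.lift.tmul,
      Algebra.TensorProduct.tmul_mul_tmul, hD.mulAct_act, hD.act_mul]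

/-- `(b · S¹)((b' b'')(T) · S²)` in terms of `S` and `T`. -/
theorem mulAct_mulAct_right (b b' b'' : B) (T S : H ⊗[k] H) :
    D.mulAct b (D.mulAct b' b'' T) S = D.mulAct₃ b b' b'' (oneTensor T * coRight Q.Δ S) := by
  induction S with
  | zero => simp
  | add x y hx hy => simp only [map_add, mul_add, hx, hy]
  | tmul g h =>
    simp only [mulAct_tmul, coRight_tmul, oneTensor_apply, Algebra.TensorProduct.tmul_mul_tmul,
      _root_.one_mul, hD.act_mulAct, mulAct₃, LinearMap.comp_apply, TensorProduct.map_tmul,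
      TensorProduct.lift.tmul]

theorem mul_mulAct_left (b b' c : B) (T : H ⊗[k] H) (h : H) :
    D.mul (D.mulAct b b' T) (D.act c h) = D.mulAct₃ b b' c
      (tensorOne₂ T * oneTensor (oneTensor h) * (↑Q.Φ⁻¹ : H ⊗[k] (H ⊗[k] H))) := by
  induction T with
  | zero => simp
  | add x y hx hy => simp only [map_add, add_mul, LinearMap.add_apply, hx, hy]
  | tmul f g =>
    rw [mulAct_tmul, hD.quasi_assoc, hD.mulAct₃_act]
    simp [tensorOne₂_tmul, oneTensor_apply]

/-- `mulAct₃` is bracketed to the right, so a product nested on the left must be rebracketed. This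
is where quasi-associativity enters and contributes `Φ⁻¹`; nesting on the right costs nothing. -/
theorem mulAct_mulAct_left (b b' b'' : B) (T S : H ⊗[k] H) :
    D.mulAct (D.mulAct b b' T) b'' S = D.mulAct₃ b b' b''
      (tensorOne₂ T * coLeft H Q.Δ S * (↑Q.Φ⁻¹ : H ⊗[k] (H ⊗[k] H))) := by
  induction S with
  | zero => simp
  | add x y hx hy => simp only [map_add, mul_add, add_mul, hx, hy]
  | tmul g h =>
    rw [mulAct_tmul, hD.act_mulAct, hD.mul_mulAct_left, coLeft_eq_mul, map_mul tensorOne₂]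
    simp only [mul_assoc, tensorOne₂]

theorem twist_mulAct (F : H ⊗[k] H) (b b' : B) (T : H ⊗[k] H) :
    (D.twist F).mulAct b b' T = D.mulAct b b' (T * F) := by
  induction T with
  | zero => simp
  | add x y hx hy => simp only [map_add, add_mul, hx, hy]
  | tmul g h => rw [mulAct_tmul, twist_mul, ← hD.mulAct_act]; rfl

/-- Each of the two twisted products contributes an `F`: the inner one gives `1 ⊗ F`, and the outer
one acts on a product, giving `(id ⊗ Δ)(F)`. -/
theorem twist_mulAct₃ (F : H ⊗[k] H) (b b' b'' : B) (T : H ⊗[k] (H ⊗[k] H)) :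
    (D.twist F).mulAct₃ b b' b'' T =
      D.mulAct₃ b b' b'' (T * (oneTensor F * coRight Q.Δ F)) := by
  induction T with
  | zero => simp
  | add x y hx hy => simp only [map_add, add_mul, hx, hy]
  | tmul f T =>
    induction T with
    | zero => simp
    | add x y hx hy => simp only [map_add, add_mul, TensorProduct.tmul_add, hx, hy]
    | tmul g h =>
      rw [mulAct₃_tmul, twist_mul, twist_mul, ← hD.mulAct₃_act, ← hD.mulAct_mulAct_right]
      rfl

end ModuleAlgebraData.IsModuleAlgebra

end Evaluation

end QuasiSmash
end

noncomputable section

set_option maxSynthPendingDepth 6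


namespace QuasiSmash

/-! ### Counits, inverses and conjugation identities in tensor powers of `H`. -/

namespace QuasiBialgebraData

variable {k H : Type*} [Field k] [Ring H] [Algebra k H] (Q : QuasiBialgebraData k H)
  (F : (H ⊗[k] H)ˣ)

variable (k H) in
/-- `id ⊗ ε : H ⊗ H → H` for an algebra map `ε`. -/
def counitRightHom (ε : H →ₐ[k] k) : H ⊗[k] H →ₐ[k] H :=
  (Algebra.TensorProduct.rid k k H).toAlgHom.comp
    (Algebra.TensorProduct.map (AlgHom.id k H) ε)

/-- `ε ⊗ id : H ⊗ X → X` for an algebra map `ε`. -/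
def counitLeftHom {X : Type*} [Ring X] [Algebra k X] (ε : H →ₐ[k] k) : H ⊗[k] X →ₐ[k] X :=
  (Algebra.TensorProduct.lid k X).toAlgHom.comp
    (Algebra.TensorProduct.map ε (AlgHom.id k X))

theorem counitRightHom_tmul (ε : H →ₐ[k] k) (g h : H) :
    counitRightHom k H ε (g ⊗ₜ h) = ε h • g := rfl

theorem counitLeftHom_tmul {X : Type*} [Ring X] [Algebra k X] (ε : H →ₐ[k] k) (g : H) (x : X) :
    counitLeftHom ε (g ⊗ₜ[k] x) = ε g • x := rfl

theorem twist_Δ (h : H) :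
    (Q.twist F).Δ h = F * Q.Δ h * (↑F⁻¹ : H ⊗[k] H) := rfl

theorem twist_Φ : (Q.twist F).Φ =
  Units.map (oneTensor (k := k) (H := H) (X := H ⊗[k] H) : _ →* _) F *
    Units.map (coRight (H := H) Q.Δ : _ →* _) F * Q.Φ *
    Units.map (coLeft H Q.Δ : _ →* _) F⁻¹ * Units.map (tensorOne₂ (k := k) (H := H) : _ →* _) F⁻¹ :=
  rfl

theorem twist_Φ_val : ((Q.twist F).Φ : H ⊗[k] (H ⊗[k] H)) =
    oneTensor (F : H ⊗[k] H) * coRight Q.Δ (F : H ⊗[k] H) * (Q.Φ : H ⊗[k] (H ⊗[k] H)) *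
      coLeft H Q.Δ (↑F⁻¹ : H ⊗[k] H) * tensorOne₂ (↑F⁻¹ : H ⊗[k] H) :=
  rfl

theorem twist_Φ_inv : (↑(Q.twist F).Φ⁻¹ : H ⊗[k] (H ⊗[k] H)) =
    tensorOne₂ (F : H ⊗[k] H) * coLeft H Q.Δ (F : H ⊗[k] H) * (↑Q.Φ⁻¹ : H ⊗[k] (H ⊗[k] H)) *
      coRight Q.Δ (↑F⁻¹ : H ⊗[k] H) * oneTensor (↑F⁻¹ : H ⊗[k] H) := by
  rw [twist_Φ]
  simp only [mul_inv_rev, ← map_inv, inv_inv, Units.val_mul, Units.coe_map, mul_assoc]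
  rfl

/-- Multiplying `f` by `u` and `v` multiplies `id ⊗ f` by `1 ⊗ u` and `1 ⊗ v`. -/
theorem coRight_mul_mul {X Y : Type*} [Ring X] [Algebra k X] [Ring Y] [Algebra k Y]
    (f g : X →ₐ[k] Y) (u v : Y) (hg : ∀ x, g x = u * f x * v) (x : H ⊗[k] X) :
    coRight g x = oneTensor u * coRight f x * oneTensor v := by
  induction x with
  | zero => simp
  | add x y hx hy => simp only [map_add, mul_add, add_mul, hx, hy]
  | tmul a b => simp [coRight_tmul, oneTensor_apply, hg]

/-- `x ↦ x ⊗ 1_X`, from `H ⊗ H` to `H ⊗ H ⊗ X`. -/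
def tensorOne (X : Type*) [Ring X] [Algebra k X] : H ⊗[k] H →ₐ[k] H ⊗[k] (H ⊗[k] X) :=
  coRight Algebra.TensorProduct.includeLeft

theorem coLeft_twist {X : Type*} [Ring X] [Algebra k X] (x : H ⊗[k] X) :
    coLeft X (Q.twist F).Δ x =
      tensorOne X (F : H ⊗[k] H) * coLeft X Q.Δ x * tensorOne X (↑F⁻¹ : H ⊗[k] H) := by
  induction x with
  | zero => simp
  | add x y hx hy => simp only [map_add, mul_add, add_mul, hx, hy]
  | tmul a b =>
    rw [coLeft_eq_mul, coLeft_eq_mul, twist_Δ, map_mul, map_mul]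
    simp only [tensorOne, mul_assoc]
    -- `F⁻¹ ⊗ 1` passes the factor `b`, which sits in the remaining slot.
    rw [(commute_coRight_oneTensor _ b).eq]

theorem coRight_twist (x : H ⊗[k] H) :
    coRight (Q.twist F).Δ x =
      oneTensor (F : H ⊗[k] H) * coRight Q.Δ x * oneTensor (↑F⁻¹ : H ⊗[k] H) :=
  coRight_mul_mul _ _ _ _ (Q.twist_Δ F) x

/-- The homomorphism of groups of units induced by an algebra map. -/
def unitsMap {M N : Type*} [Ring M] [Ring N] [Algebra k M] [Algebra k N]
    (f : M →ₐ[k] N) : Mˣ →* Nˣ := Units.map (f : M →* N)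

theorem val_unitsMap {M N : Type*} [Ring M] [Ring N] [Algebra k M] [Algebra k N]
    (f : M →ₐ[k] N) (u : Mˣ) : (unitsMap f u : N) = f u := rfl

theorem map_units_mul_inv {M N : Type*} [Ring M] [Ring N] [Algebra k M] [Algebra k N]
    (f : M →ₐ[k] N) (u : Mˣ) : f u * f (↑u⁻¹ : M) = 1 := by
  rw [← map_mul, Units.mul_inv, map_one]

theorem map_units_inv_mul {M N : Type*} [Ring M] [Ring N] [Algebra k M] [Algebra k N]
    (f : M →ₐ[k] N) (u : Mˣ) : f (↑u⁻¹ : M) * f u = 1 := by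
  rw [← map_mul, Units.inv_mul, map_one]

theorem map_units_inv_mul_cancel {M N : Type*} [Ring M] [Ring N] [Algebra k M] [Algebra k N]
    (f : M →ₐ[k] N) (u : Mˣ) (x : N) : f (↑u⁻¹ : M) * (f u * x) = x := by
  rw [← mul_assoc, map_units_inv_mul, one_mul]

theorem coRight_coLeft_tensorOne₂ (f : H →ₐ[k] H ⊗[k] H) (t : H ⊗[k] H) :
    coRight (coLeft H f) (tensorOne₂ t) = tensorOne₃ (coRight f t) := by
  rw [tensorOne₂, tensorOne₃, coRight_coRight, coRight_coRight]
  congr 2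
  refine AlgHom.ext fun h => ?_
  simp [coLeft_tmul, tensorOne₂_eq]

theorem coLeft_tensorOne₂ (f : H →ₐ[k] H ⊗[k] H) (t : H ⊗[k] H) :
    coLeft (H ⊗[k] H) f (tensorOne₂ t) = tensorOne₃ (coLeft H f t) := by
  rw [tensorOne₂, coLeft_coRight]; rfl

theorem tensorOne₃_tensorOne₂ (t : H ⊗[k] H) :
    tensorOne₃ (tensorOne₂ t) = tensorOne (H ⊗[k] H) t := by
  rw [tensorOne₃, tensorOne₂, tensorOne, coRight_coRight]
  rfl

theorem coRight_coRight_tensorOne₂ (f : H →ₐ[k] H ⊗[k] H) (t : H ⊗[k] H) :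
    coRight (coRight f) (tensorOne₂ t) = tensorOne (H ⊗[k] H) t := by
  rw [tensorOne₂, tensorOne, coRight_coRight]
  congr 2
  refine AlgHom.ext fun h => ?_
  simp [coRight_tmul, Algebra.TensorProduct.one_def]

section CounitCollapse

variable {Q}

theorem counitLeftHom_oneTensor {X : Type*} [Ring X] [Algebra k X] (ε : H →ₐ[k] k) (x : X) :
    counitLeftHom ε (oneTensor (k := k) (H := H) x) = x := by
  simp [oneTensor_apply, counitLeftHom_tmul]

/-- `(id ⊗ ε ⊗ id)(T ⊗ 1) = (id ⊗ ε)(T) ⊗ 1`. -/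
theorem coRight_counitLeftHom_tensorOne {X : Type*} [Ring X] [Algebra k X] (ε : H →ₐ[k] k)
    (T : H ⊗[k] H) :
    coRight (counitLeftHom ε) (tensorOne X T) = counitRightHom k H ε T ⊗ₜ 1 := by
  induction T with
  | zero => simp
  | add x y hx hy => simp only [map_add, TensorProduct.add_tmul, hx, hy]
  | tmul a b =>
    simp [tensorOne, coRight_tmul, counitLeftHom_tmul, counitRightHom_tmul,
      TensorProduct.smul_tmul]

namespace IsQuasiBialgebra

variable (hQ : Q.IsQuasiBialgebra)
include hQ

theorem counitLeftHom_Δ (h : H) : counitLeftHom Q.ε (Q.Δ h) = h := hQ.counit_left h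

theorem counitRightHom_Δ (h : H) : counitRightHom k H Q.ε (Q.Δ h) = h := hQ.counit_right h

theorem coRight_counitLeftHom_Φ : coRight (counitLeftHom Q.ε) (Q.Φ : H ⊗[k] (H ⊗[k] H)) = 1 :=
  hQ.counit_Φ

theorem coRight_counitLeftHom_coRight (T : H ⊗[k] H) :
    coRight (counitLeftHom Q.ε) (coRight Q.Δ T) = T := by
  induction T with
  | zero => simp
  | add x y hx hy => simp only [map_add, hx, hy]
  | tmul a b => rw [coRight_tmul, coRight_tmul, hQ.counitLeftHom_Δ]

theorem coRight_counitLeftHom_coLeft {X : Type*} [Ring X] [Algebra k X] (T : H ⊗[k] X) :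
    coRight (counitLeftHom Q.ε) (coLeft X Q.Δ T) = T := by
  induction T with
  | zero => simp
  | add x y hx hy => simp only [map_add, hx, hy]
  | tmul a b =>
    rw [coLeft_eq_mul, map_mul, ← tensorOne, coRight_counitLeftHom_tensorOne,
      hQ.counitRightHom_Δ, coRight_oneTensor, counitLeftHom_oneTensor, oneTensor_apply]
    simp

/-- `(id ⊗ id ⊗ ε)(Φ) = 1 ⊗ 1`. -/
theorem coRight_counitRightHom_Φ :
    coRight (counitRightHom k H Q.ε) (Q.Φ : H ⊗[k] (H ⊗[k] H)) = 1 := by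
  -- Applying `id ⊗ id ⊗ ε ⊗ id` to the pentagon collapses it to `Φ · ((id ⊗ id ⊗ ε)(Φ) ⊗ 1) = Φ`,
  -- and `Φ` cancels.
  have h := congrArg (coRight (coRight (counitLeftHom Q.ε))) hQ.pentagon
  have e₁ : coRight (coRight (counitLeftHom Q.ε)) (coRight (coLeft H Q.Δ)
      (Q.Φ : H ⊗[k] (H ⊗[k] H))) = Q.Φ := by
    rw [coRight_coRight]
    have : (coRight (counitLeftHom Q.ε)).comp (coLeft H Q.Δ) = AlgHom.id k (H ⊗[k] H) :=
      AlgHom.ext hQ.coRight_counitLeftHom_coLeft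
    rw [this, coRight, Algebra.TensorProduct.map_id]
    rfl
  have e₂ : coRight (coRight (counitLeftHom Q.ε)) (coRight (coRight Q.Δ)
      (Q.Φ : H ⊗[k] (H ⊗[k] H))) = Q.Φ := by
    rw [coRight_coRight]
    have : (coRight (counitLeftHom Q.ε)).comp (coRight Q.Δ) = AlgHom.id k (H ⊗[k] H) :=
      AlgHom.ext hQ.coRight_counitLeftHom_coRight
    rw [this, coRight, Algebra.TensorProduct.map_id]
    rfl
  rw [map_mul, map_mul, map_mul, e₁, e₂, coRight_oneTensor, hQ.coRight_counitLeftHom_Φ,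
    ← coLeft_coRight, hQ.coRight_counitLeftHom_Φ, map_one, map_one, one_mul, mul_one] at h
  have h' := congrArg ((↑Q.Φ⁻¹ : H ⊗[k] (H ⊗[k] H)) * ·) h
  simp only [Units.inv_mul_cancel_left, Units.inv_mul] at h'
  have e₃ : ∀ T : H ⊗[k] (H ⊗[k] H), coRight (coRight (counitLeftHom Q.ε)) (tensorOne₃ T) =
      tensorOne₂ (coRight (counitRightHom k H Q.ε) T) := fun T => by
    rw [tensorOne₃, tensorOne₂, coRight_coRight, coRight_coRight]
    congr 2
    refine AlgHom.ext fun T => ?_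
    exact coRight_counitLeftHom_tensorOne Q.ε T
  -- A left inverse of `tensorOne₂`, used to strip the trailing `⊗ 1`.
  have e₄ : ∀ T : H ⊗[k] H, coRight (counitRightHom k H Q.ε) (tensorOne₂ T) = T := fun T => by
    induction T with
    | zero => simp
    | add x y hx hy => simp only [map_add, hx, hy]
    | tmul a b => simp [tensorOne₂_tmul, coRight_tmul, counitRightHom_tmul]
  rw [← e₄ (coRight _ _), ← e₃, h', map_one]

theorem inv_quasi_coassoc (h : H) :
    coLeft H Q.Δ (Q.Δ h) * (↑Q.Φ⁻¹ : H ⊗[k] (H ⊗[k] H)) =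
      (↑Q.Φ⁻¹ : H ⊗[k] (H ⊗[k] H)) * coRight Q.Δ (Q.Δ h) := by
  rw [Units.mul_inv_eq_iff_eq_mul, mul_assoc, hQ.quasi_coassoc, Units.inv_mul_cancel_left]

theorem coRight_counitLeftHom_Φ_inv :
    coRight (counitLeftHom Q.ε) (↑Q.Φ⁻¹ : H ⊗[k] (H ⊗[k] H)) = 1 := by
  have := map_units_mul_inv (coRight (counitLeftHom Q.ε)) Q.Φ
  rwa [hQ.coRight_counitLeftHom_Φ, one_mul] at this

theorem coRight_counitRightHom_Φ_inv :
    coRight (counitRightHom k H Q.ε) (↑Q.Φ⁻¹ : H ⊗[k] (H ⊗[k] H)) = 1 := by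
  have := map_units_mul_inv (coRight (counitRightHom k H Q.ε)) Q.Φ
  rwa [hQ.coRight_counitRightHom_Φ, one_mul] at this

/-- The inverse of the pentagon identity. -/
theorem inv_pentagon :
    coLeft (H ⊗[k] H) Q.Δ (↑Q.Φ⁻¹ : H ⊗[k] (H ⊗[k] H)) *
        coRight (coRight Q.Δ) (↑Q.Φ⁻¹ : H ⊗[k] (H ⊗[k] H)) =
      tensorOne₃ (↑Q.Φ⁻¹ : H ⊗[k] (H ⊗[k] H)) *
        coRight (coLeft H Q.Δ) (↑Q.Φ⁻¹ : H ⊗[k] (H ⊗[k] H)) *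
          oneTensor (↑Q.Φ⁻¹ : H ⊗[k] (H ⊗[k] H)) := by
  have h : unitsMap oneTensor Q.Φ * unitsMap (coRight (coLeft H Q.Δ)) Q.Φ *
      unitsMap tensorOne₃ Q.Φ =
      unitsMap (coRight (coRight Q.Δ)) Q.Φ * unitsMap (coLeft (H ⊗[k] H) Q.Δ) Q.Φ :=
    Units.ext hQ.pentagon
  have h' := congrArg Inv.inv h
  simp only [mul_inv_rev, ← map_inv, ← mul_assoc] at h'
  exact (congrArg Units.val h').symm

/-- `(id ⊗ (id ⊗ Δ)Δ)(T)` and `(id ⊗ (Δ ⊗ id)Δ)(T)` are conjugate by `1 ⊗ Φ`. -/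
theorem oneTensor_Φ_mul (T : H ⊗[k] H) :
    oneTensor (Q.Φ : H ⊗[k] (H ⊗[k] H)) * coRight (coLeft H Q.Δ) (coRight Q.Δ T) =
      coRight (coRight Q.Δ) (coRight Q.Δ T) * oneTensor (Q.Φ : H ⊗[k] (H ⊗[k] H)) := by
  induction T with
  | zero => simp
  | add x y hx hy => simp only [map_add, mul_add, add_mul, hx, hy]
  | tmul a b =>
    simp only [coRight_tmul, oneTensor_apply, Algebra.TensorProduct.tmul_mul_tmul, one_mul,
      mul_one, hQ.quasi_coassoc]

/-- `((id ⊗ Δ)Δ ⊗ id)(T)` and `((Δ ⊗ id)Δ ⊗ id)(T)` are conjugate by `Φ ⊗ 1`. -/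
theorem mul_tensorOne₃_Φ (T : H ⊗[k] H) :
    coRight (coLeft H Q.Δ) (coLeft H Q.Δ T) * tensorOne₃ (Q.Φ : H ⊗[k] (H ⊗[k] H)) =
      tensorOne₃ (Q.Φ : H ⊗[k] (H ⊗[k] H)) * coLeft (H ⊗[k] H) Q.Δ (coLeft H Q.Δ T) := by
  -- `S ⊗ 1` commutes with the fourth slot, so only quasi-coassociativity of the first leg of `T` is
  -- at stake.
  have comm : ∀ (S : H ⊗[k] (H ⊗[k] H)) (h : H), Commute (tensorOne₃ S)
      (oneTensor (k := k) (H := H) (oneTensor (k := k) (H := H)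
        (oneTensor (k := k) (H := H) h))) := fun S h => by
    induction S with
    | zero => simp
    | add x y hx hy => rw [map_add]; exact hx.add_left hy
    | tmul a S =>
      have := (commute_coRight_oneTensor (H := H) S h).eq
      simp only [commute_iff_eq, tensorOne₃, coRight_tmul, oneTensor_apply, tensorOne₂,
        Algebra.TensorProduct.tmul_mul_tmul, mul_one, one_mul] at *
      rw [this]
  induction T with
  | zero => simp
  | add x y hx hy => simp only [map_add, mul_add, add_mul, hx, hy]
  | tmul a b =>
    rw [coLeft_eq_mul, ← tensorOne₂, map_mul, map_mul, coRight_coLeft_tensorOne₂,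
      coLeft_tensorOne₂, coRight_oneTensor,
      coLeft_oneTensor, coLeft_oneTensor, mul_assoc, ← (comm _ b).eq, ← mul_assoc, ← map_mul,
      hQ.quasi_coassoc, map_mul, mul_assoc]

end IsQuasiBialgebra

end CounitCollapse

/-- The group-theoretic content of the invariance of the pentagon identity under twisting. -/
theorem pentagon_of_conj {G : Type*} [Group G]
    {f₁₂ f₂₃ f₃₄ f₁_23 f₁₂_3 f₂_34 f₂₃_4 f₁₂_34 p p' q q' φ₁₂₃ φ₂₃₄ φ₁_23_4 φ₁_2_34 φ₁₂_3_4 : G}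
    (hf : Commute f₁₂ f₃₄) (hp : φ₂₃₄ * p = p' * φ₂₃₄) (hq : q * φ₁₂₃ = φ₁₂₃ * q')
    (hφ : φ₂₃₄ * φ₁_23_4 * φ₁₂₃ = φ₁_2_34 * φ₁₂_3_4) :
    (f₃₄ * f₂_34 * φ₂₃₄ * f₂₃_4⁻¹ * f₂₃⁻¹) *
        (f₂₃ * (f₂₃_4 * p * φ₁_23_4 * q * f₁_23⁻¹) * f₂₃⁻¹) *
        (f₂₃ * f₁_23 * φ₁₂₃ * f₁₂_3⁻¹ * f₁₂⁻¹) =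
      (f₃₄ * (f₂_34 * p' * φ₁_2_34 * f₁₂_34⁻¹ * f₁₂⁻¹) * f₃₄⁻¹) *
        (f₁₂ * (f₃₄ * f₁₂_34 * φ₁₂_3_4 * q' * f₁₂_3⁻¹) * f₁₂⁻¹) := by
  -- This trivial word is inserted between `φ₁_2_34` and `φ₁₂_3_4`; it accounts for the conjugations
  -- by `f₁₂` and `f₃₄` on the right-hand side.
  have hf' : f₁₂⁻¹ * (f₃₄⁻¹ * (f₁₂ * f₃₄)) = 1 := by rw [hf.eq]; group
  calc _ = f₃₄ * f₂_34 * (φ₂₃₄ * p) * φ₁_23_4 * (q * φ₁₂₃) * f₁₂_3⁻¹ * f₁₂⁻¹ := by group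
    -- Moving `p` left and `q` right across the outer associators makes the three associators
    -- adjacent, ready for `hφ`.
    _ = f₃₄ * f₂_34 * p' * (φ₂₃₄ * φ₁_23_4 * φ₁₂₃) * q' * f₁₂_3⁻¹ * f₁₂⁻¹ := by
      rw [hp, hq]; group
    _ = f₃₄ * f₂_34 * p' * φ₁_2_34 * f₁₂_34⁻¹ * (f₁₂⁻¹ * (f₃₄⁻¹ * (f₁₂ * f₃₄))) * f₁₂_34 *
        φ₁₂_3_4 * q' * f₁₂_3⁻¹ * f₁₂⁻¹ := by rw [hf', hφ]; group
    _ = _ := by group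

end QuasiBialgebraData
end QuasiSmash
end

noncomputable section

set_option maxSynthPendingDepth 6


namespace QuasiSmash

/-! ### The twisted quasi-bialgebra. -/

namespace QuasiBialgebraData

variable {k H : Type*} [Field k] [Ring H] [Algebra k H] {Q : QuasiBialgebraData k H}
  {F : (H ⊗[k] H)ˣ}

theorem twist_quasi_coassoc (hQ : Q.IsQuasiBialgebra) (h : H) :
    coRight (Q.twist F).Δ ((Q.twist F).Δ h) * (Q.twist F).Φ =
      (Q.twist F).Φ * coLeft H (Q.twist F).Δ ((Q.twist F).Δ h) := by
  rw [coRight_twist, coLeft_twist, twist_Φ_val]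
  change _ = _ * (tensorOne₂ (F : H ⊗[k] H) * _ * tensorOne₂ (↑F⁻¹ : H ⊗[k] H))
  simp only [twist_Δ, map_mul, mul_assoc, map_units_inv_mul_cancel]
  rw [← mul_assoc (coRight Q.Δ (Q.Δ h)), hQ.quasi_coassoc]
  simp only [mul_assoc]

theorem tensorOne_eq_tensorOne₂ (t : H ⊗[k] H) : tensorOne H t = tensorOne₂ t := rfl

theorem IsGauge.counitLeftHom (hF : Q.IsGauge F) :
    counitLeftHom Q.ε (F : H ⊗[k] H) = 1 := hF.counit_left

theorem IsGauge.counitRightHom (hF : Q.IsGauge F) :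
    counitRightHom k H Q.ε (F : H ⊗[k] H) = 1 := hF.counit_right

theorem IsGauge.inv (hF : Q.IsGauge F) : Q.IsGauge F⁻¹ where
  counit_left := by
    have := map_units_mul_inv (QuasiBialgebraData.counitLeftHom Q.ε) F
    rwa [hF.counitLeftHom, one_mul] at this
  counit_right := by
    have := map_units_mul_inv (QuasiBialgebraData.counitRightHom k H Q.ε) F
    rwa [hF.counitRightHom, one_mul] at this

theorem twist_pentagon (hQ : Q.IsQuasiBialgebra) :
    oneTensor (k := k) (H := H) ((Q.twist F).Φ : H ⊗[k] (H ⊗[k] H)) *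
        coRight (coLeft H (Q.twist F).Δ) (Q.twist F).Φ * tensorOne₃ (Q.twist F).Φ =
      coRight (coRight (Q.twist F).Δ) ((Q.twist F).Φ : H ⊗[k] (H ⊗[k] H)) *
        coLeft (H ⊗[k] H) (Q.twist F).Δ (Q.twist F).Φ := by
  -- Digits name the four slots and `_` separates the legs: `f₁₂_3` is `(Δ ⊗ id)(F) ⊗ 1`, `φ₁_23_4`
  -- is `(id ⊗ Δ ⊗ id)(Φ)`. The letters `p`, `p'` are the two iterated coproducts on the second leg
  -- of `F`, and `q`, `q'` those on the first leg of `F⁻¹`.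
  have key := pentagon_of_conj (G := (H ⊗[k] (H ⊗[k] (H ⊗[k] H)))ˣ)
    (f₁₂ := unitsMap (tensorOne (H ⊗[k] H)) F)
    (f₂₃ := unitsMap oneTensor (unitsMap tensorOne₂ F))
    (f₃₄ := unitsMap oneTensor (unitsMap oneTensor F))
    (f₁_23 := unitsMap tensorOne₃ (unitsMap (coRight Q.Δ) F))
    (f₁₂_3 := unitsMap tensorOne₃ (unitsMap (coLeft H Q.Δ) F))
    (f₂_34 := unitsMap oneTensor (unitsMap (coRight Q.Δ) F))
    (f₂₃_4 := unitsMap oneTensor (unitsMap (coLeft H Q.Δ) F))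
    (f₁₂_34 := unitsMap (coLeft (H ⊗[k] H) Q.Δ) (unitsMap (coRight Q.Δ) F))
    (p := unitsMap (coRight (coLeft H Q.Δ)) (unitsMap (coRight Q.Δ) F))
    (p' := unitsMap (coRight (coRight Q.Δ)) (unitsMap (coRight Q.Δ) F))
    (q := unitsMap (coRight (coLeft H Q.Δ)) (unitsMap (coLeft H Q.Δ) F⁻¹))
    (q' := unitsMap (coLeft (H ⊗[k] H) Q.Δ) (unitsMap (coLeft H Q.Δ) F⁻¹))
    (φ₁₂₃ := unitsMap tensorOne₃ Q.Φ) (φ₂₃₄ := unitsMap oneTensor Q.Φ)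
    (φ₁_23_4 := unitsMap (coRight (coLeft H Q.Δ)) Q.Φ)
    (φ₁_2_34 := unitsMap (coRight (coRight Q.Δ)) Q.Φ)
    (φ₁₂_3_4 := unitsMap (coLeft (H ⊗[k] H) Q.Δ) Q.Φ)
    (Units.ext (commute_coRight_oneTensor _ _).eq)
    (Units.ext (hQ.oneTensor_Φ_mul _)) (Units.ext (hQ.mul_tensorOne₃_Φ _))
    (Units.ext hQ.pentagon)
  have key' := congrArg Units.val key
  simp only [Units.val_mul, ← map_inv, val_unitsMap] at key'
  have e₁ : ∀ x : H ⊗[k] (H ⊗[k] H), coRight (coLeft H (Q.twist F).Δ) x =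
      oneTensor (tensorOne₂ (F : H ⊗[k] H)) * coRight (coLeft H Q.Δ) x *
        oneTensor (tensorOne₂ (↑F⁻¹ : H ⊗[k] H)) :=
    coRight_mul_mul (coLeft H Q.Δ) _ _ _ (Q.coLeft_twist F)
  have e₂ : ∀ x : H ⊗[k] (H ⊗[k] H), coRight (coRight (Q.twist F).Δ) x =
      oneTensor (oneTensor (F : H ⊗[k] H)) * coRight (coRight Q.Δ) x *
        oneTensor (oneTensor (↑F⁻¹ : H ⊗[k] H)) :=
    coRight_mul_mul (coRight Q.Δ) _ _ _ (Q.coRight_twist F)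
  have e₃ : ∀ x : H ⊗[k] H, tensorOne₃ (oneTensor x) =
      oneTensor (k := k) (H := H) (tensorOne₂ x) := fun _ => rfl
  rw [e₁, e₂, coLeft_twist, twist_Φ_val]
  simp only [map_mul, coRight_oneTensor, coLeft_oneTensor, coRight_coLeft_tensorOne₂,
    coLeft_tensorOne₂, coRight_coRight_tensorOne₂, tensorOne₃_tensorOne₂, e₃, ← coLeft_coRight]
  exact key'

theorem IsQuasiBialgebra.twist (hQ : Q.IsQuasiBialgebra) (hF : Q.IsGauge F) :
    (Q.twist F).IsQuasiBialgebra where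
  quasi_coassoc := twist_quasi_coassoc hQ
  counit_left h := by
    change QuasiBialgebraData.counitLeftHom Q.ε ((F : H ⊗[k] H) * Q.Δ h * (↑F⁻¹ : H ⊗[k] H)) = h
    rw [map_mul, map_mul, hF.counitLeftHom, hF.inv.counitLeftHom, hQ.counitLeftHom_Δ, one_mul,
      mul_one]
  counit_right h := by
    change QuasiBialgebraData.counitRightHom k H Q.ε ((F : H ⊗[k] H) * Q.Δ h * (↑F⁻¹ : H ⊗[k] H)) = h
    rw [map_mul, map_mul, hF.counitRightHom, hF.inv.counitRightHom, hQ.counitRightHom_Δ, one_mul,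
      mul_one]
  pentagon := twist_pentagon hQ
  counit_Φ := by
    change coRight (QuasiBialgebraData.counitLeftHom Q.ε) _ = 1
    rw [twist_Φ_val, map_mul, map_mul, map_mul, map_mul, coRight_oneTensor, hF.counitLeftHom,
      hQ.coRight_counitLeftHom_coRight, hQ.coRight_counitLeftHom_Φ,
      hQ.coRight_counitLeftHom_coLeft, ← tensorOne_eq_tensorOne₂,
      coRight_counitLeftHom_tensorOne, hF.inv.counitRightHom, map_one, one_mul, mul_one,
      Units.mul_inv, ← Algebra.TensorProduct.one_def, mul_one]

end QuasiBialgebraData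

/-! ### The twisted module algebra. -/

namespace ModuleAlgebraData.IsModuleAlgebra

variable {k H B : Type*} [Field k] [Ring H] [Algebra k H] [AddCommGroup B] [Module k B]
  {Q : QuasiBialgebraData k H} {D : ModuleAlgebraData k H B} {F : (H ⊗[k] H)ˣ}

open QuasiBialgebraData

theorem mulAct_one_left (hD : D.IsModuleAlgebra Q) (b : B) (T : H ⊗[k] H) :
    D.mulAct D.one b T = D.act b (counitLeftHom Q.ε T) := by
  induction T with
  | zero => simp
  | add x y hx hy => simp only [map_add, hx, hy]
  | tmul g h => simp [mulAct_tmul, hD.one_act, hD.one_mul, counitLeftHom_tmul]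

theorem mulAct_one_right (hD : D.IsModuleAlgebra Q) (b : B) (T : H ⊗[k] H) :
    D.mulAct b D.one T = D.act b (counitRightHom k H Q.ε T) := by
  induction T with
  | zero => simp
  | add x y hx hy => simp only [map_add, hx, hy]
  | tmul g h => simp [mulAct_tmul, hD.one_act, hD.mul_one, counitRightHom_tmul]

/-- In quasi-associativity, the two copies of `F` from `twist_mulAct₃` cancel the right end of
`Φ_F⁻¹`. What is left, `(F ⊗ 1)(Δ ⊗ id)(F) Φ⁻¹`, is the tensor of the left-bracketed twisted
product. -/
theorem twist (hD : D.IsModuleAlgebra Q) (hF : Q.IsGauge F) :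
    (D.twist (F : H ⊗[k] H)).IsModuleAlgebra (Q.twist F) where
  act_one := hD.act_one
  act_mul := hD.act_mul
  one_mul b := by
    change D.mulAct D.one b F = b
    rw [hD.mulAct_one_left, hF.counitLeftHom, hD.act_one]
  mul_one b := by
    change D.mulAct b D.one F = b
    rw [hD.mulAct_one_right, hF.counitRightHom, hD.act_one]
  mul_act b b' h := by
    rw [hD.twist_mulAct, twist_Δ, Units.inv_mul_cancel_right, ← hD.act_mulAct]
    rfl
  one_act := hD.one_act
  quasi_assoc b b' b'' := by
    rw [hD.twist_mulAct₃, twist_mul, twist_mul, hD.mulAct_mulAct_left, twist_Φ_inv]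
    simp only [mul_assoc, map_units_inv_mul_cancel, map_units_inv_mul, _root_.mul_one]

end ModuleAlgebraData.IsModuleAlgebra
end QuasiSmash
end

noncomputable section

set_option maxSynthPendingDepth 6


namespace QuasiSmash

/-! ### Crossed products on elements. -/

section CrossedProducts

variable {k A V X : Type*} [Field k] [Ring A] [Algebra k A]
  [AddCommGroup V] [Module k V] [AddCommGroup X] [Module k X]

theorem ext₁_tmul (f : V →ₗ[k] A ⊗[k] V) (a : A) (v : V) :
    ext₁ f (a ⊗ₜ v) = mulId k A V (a ⊗ₜ f v) := rfl

theorem ext₂_tmul (f : V ⊗[k] X →ₗ[k] A ⊗[k] V) (a : A) (v : V) (x : X) :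
    ext₂ f ((a ⊗ₜ v) ⊗ₜ x) = mulId k A V (a ⊗ₜ f (v ⊗ₜ x)) := rfl

theorem crossedMulMap_tmul (R : V ⊗[k] A →ₗ[k] A ⊗[k] V) (σ : V ⊗[k] V →ₗ[k] A ⊗[k] V)
    (x : A ⊗[k] V) (a : A) (v : V) :
    crossedMulMap R σ (x ⊗ₜ (a ⊗ₜ v)) = ext₂ σ (ext₂ R (x ⊗ₜ a) ⊗ₜ v) := rfl

theorem mulId_one_tmul (x : A ⊗[k] V) : mulId k A V (1 ⊗ₜ x) = x := by
  induction x with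
  | zero => simp
  | add x y hx hy => simp only [TensorProduct.tmul_add, map_add, hx, hy]
  | tmul a v => rw [mulId_tmul, one_mul]

/-- Turns the left-hand sides of the cocycle and twisted module conditions into crossed products
with `1 ⊗ v`. -/
theorem ext₂_rTensor_assoc_symm (R : V ⊗[k] A →ₗ[k] A ⊗[k] V) (σ : V ⊗[k] V →ₗ[k] A ⊗[k] V)
    (v : V) (y : A ⊗[k] V) :
    ext₂ σ (R.rTensor V ((TensorProduct.assoc k V A V).symm (v ⊗ₜ y))) =
      crossedMulMap R σ ((1 ⊗ₜ v) ⊗ₜ y) := by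
  induction y with
  | zero => simp
  | add x y hx hy => simp only [TensorProduct.tmul_add, map_add, hx, hy]
  | tmul a w =>
    rw [crossedMulMap_tmul, ext₂_tmul, mulId_one_tmul]
    rfl

end CrossedProducts

/-! ### The smash product as a crossed product. -/

namespace ModuleAlgebraData

open QuasiBialgebraData

variable {k H B : Type*} [Field k] [Ring H] [Algebra k H] [AddCommGroup B] [Module k B]
  {Q : QuasiBialgebraData k H} {D : ModuleAlgebraData k H B}

theorem ext₂_smashR (x : H ⊗[k] B) (h : H) :
    ext₂ (D.smashR Q) (x ⊗ₜ h) = ext₁ (D.legAct (Q.Δ h)) x := by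
  induction x with
  | zero => simp
  | add x y hx hy => simp only [TensorProduct.add_tmul, map_add, hx, hy]
  | tmul a b => rfl

namespace IsModuleAlgebra

variable (hD : D.IsModuleAlgebra Q)
include hD

theorem legAct_tmul_one (h : H) (b : B) : D.legAct (h ⊗ₜ 1) b = h ⊗ₜ b := by
  rw [legAct_tmul, hD.act_one]

/-- `S` acts after `T`, hence the order `T * S`. In particular `F` and `F⁻¹` give mutually inverse
maps. -/
theorem ext₁_legAct (S T : H ⊗[k] H) (b : B) :
    ext₁ (D.legAct S) (D.legAct T b) = D.legAct (T * S) b := by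
  induction T with
  | zero => simp [legAct_zero]
  | add x y hx hy => simp only [legAct_add, map_add, add_mul, hx, hy]
  | tmul g h =>
    rw [legAct_tmul, ext₁_tmul, hD.legAct_act, mulId_legAct, ← mul_assoc,
      Algebra.TensorProduct.tmul_mul_tmul, _root_.mul_one, _root_.one_mul]

theorem ext₁_legAct_comp (S T : H ⊗[k] H) (x : H ⊗[k] B) :
    ext₁ (D.legAct S) (ext₁ (D.legAct T) x) = ext₁ (D.legAct (T * S)) x := by
  induction x with
  | zero => simp
  | add x y hx hy => simp only [map_add, hx, hy]
  | tmul h b => simp only [← hD.legAct_tmul_one, hD.ext₁_legAct, mul_assoc]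

theorem ext₁_legAct_one (x : H ⊗[k] B) : ext₁ (D.legAct 1) x = x := by
  induction x with
  | zero => simp
  | add x y hx hy => simp only [map_add, hx, hy]
  | tmul h b => simp only [← hD.legAct_tmul_one, hD.ext₁_legAct, _root_.mul_one]

theorem legAct_mulAct (b b' : B) (T S : H ⊗[k] H) :
    D.legAct S (D.mulAct b b' T) =
      (D.mulAct b b').lTensor H (oneTensor T * coRight Q.Δ S) := by
  induction S with
  | zero => simp [legAct_zero]
  | add x y hx hy => simp only [legAct_add, map_add, mul_add, hx, hy]
  | tmul g h =>
    rw [legAct_tmul, hD.act_mulAct, coRight_tmul, oneTensor_apply,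
      Algebra.TensorProduct.tmul_mul_tmul, _root_.one_mul, LinearMap.lTensor_tmul]

theorem ext₁_legAct_lTensor (b b' : B) (T : H ⊗[k] (H ⊗[k] H)) (S : H ⊗[k] H) :
    ext₁ (D.legAct S) ((D.mulAct b b').lTensor H T) =
      (D.mulAct b b').lTensor H (T * coRight Q.Δ S) := by
  induction T with
  | zero => simp
  | add x y hx hy => simp only [map_add, add_mul, hx, hy]
  | tmul f t =>
    rw [LinearMap.lTensor_tmul, ext₁_tmul, hD.legAct_mulAct, mulId_lTensor, ← mul_assoc,
      oneTensor_apply, Algebra.TensorProduct.tmul_mul_tmul, _root_.mul_one, _root_.one_mul]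

theorem lTensor_mulAct_act_left (b b' : B) (h : H) (T : H ⊗[k] (H ⊗[k] H)) :
    (D.mulAct (D.act b h) b').lTensor H T =
      (D.mulAct b b').lTensor H (oneTensor (h ⊗ₜ 1) * T) := by
  induction T with
  | zero => simp
  | add x y hx hy => simp only [map_add, mul_add, hx, hy]
  | tmul f t =>
    rw [oneTensor_apply, Algebra.TensorProduct.tmul_mul_tmul, _root_.one_mul,
      LinearMap.lTensor_tmul, LinearMap.lTensor_tmul, ← hD.mulAct_act, hD.act_one]

theorem lTensor_mulAct_act_right (b b' : B) (h : H) (T : H ⊗[k] (H ⊗[k] H)) :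
    (D.mulAct b (D.act b' h)).lTensor H T =
      (D.mulAct b b').lTensor H (oneTensor (oneTensor h) * T) := by
  induction T with
  | zero => simp
  | add x y hx hy => simp only [map_add, mul_add, hx, hy]
  | tmul f t =>
    rw [oneTensor_apply, oneTensor_apply, Algebra.TensorProduct.tmul_mul_tmul, _root_.one_mul,
      LinearMap.lTensor_tmul, LinearMap.lTensor_tmul, ← hD.mulAct_act, hD.act_one]

theorem ext₂_smashσ_legAct (b b' : B) (T : H ⊗[k] H) :
    ext₂ (D.smashσ Q) (D.legAct T b ⊗ₜ b') =
      (D.mulAct b b').lTensor H (tensorOne₂ T * (↑Q.Φ⁻¹ : H ⊗[k] (H ⊗[k] H))) := by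
  induction T with
  | zero => simp [legAct_zero]
  | add x y hx hy => simp only [legAct_add, TensorProduct.add_tmul, map_add, add_mul, hx, hy]
  | tmul g h =>
    rw [legAct_tmul, ext₂_tmul, smashσ_tmul, hD.lTensor_mulAct_act_left, mulId_lTensor,
      ← mul_assoc, oneTensor_apply, Algebra.TensorProduct.tmul_mul_tmul, _root_.mul_one,
      _root_.one_mul, tensorOne₂_tmul]

/-- `R` carries the first leg of `S` across `b`, splitting it by `Δ`; then `σ` appends `Φ⁻¹`. -/
theorem crossedMulMap_legAct (b b' : B) (T S : H ⊗[k] H) :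
    crossedMulMap (D.smashR Q) (D.smashσ Q) (D.legAct T b ⊗ₜ D.legAct S b') =
      (D.mulAct b b').lTensor H
        (tensorOne₂ T * coLeft H Q.Δ S * (↑Q.Φ⁻¹ : H ⊗[k] (H ⊗[k] H))) := by
  induction S with
  | zero => simp [legAct_zero]
  | add x y hx hy =>
    simp only [legAct_add, TensorProduct.tmul_add, map_add, mul_add, add_mul, hx, hy]
  | tmul g h =>
    rw [legAct_tmul, crossedMulMap_tmul, ext₂_smashR, hD.ext₁_legAct, hD.ext₂_smashσ_legAct,
      hD.lTensor_mulAct_act_right, coLeft_eq_mul, ← mul_assoc, ← mul_assoc, ← tensorOne₂, ← map_mul,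
      tensorOne₂, (commute_coRight_oneTensor _ h).eq]

theorem lTensor_mulAct_mulAct_left (b b' b'' : B) (t : H ⊗[k] H) (S : H ⊗[k] (H ⊗[k] H)) :
    (D.mulAct (D.mulAct b b' t) b'').lTensor H S =
      (D.mulAct₃ b b' b'').lTensor H (oneTensor (tensorOne₂ t) * coRight (coLeft H Q.Δ) S *
        oneTensor (↑Q.Φ⁻¹ : H ⊗[k] (H ⊗[k] H))) := by
  induction S with
  | zero => simp
  | add x y hx hy => simp only [map_add, mul_add, add_mul, hx, hy]
  | tmul f s =>
    simp only [oneTensor_apply, coRight_tmul, Algebra.TensorProduct.tmul_mul_tmul, _root_.one_mul,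
      _root_.mul_one, LinearMap.lTensor_tmul, hD.mulAct_mulAct_left]

theorem lTensor_mulAct_mulAct_right (b b' b'' : B) (t : H ⊗[k] H) (S : H ⊗[k] (H ⊗[k] H)) :
    (D.mulAct b (D.mulAct b' b'' t)).lTensor H S =
      (D.mulAct₃ b b' b'').lTensor H
        (oneTensor (oneTensor t) * coRight (coRight Q.Δ) S) := by
  induction S with
  | zero => simp
  | add x y hx hy => simp only [map_add, mul_add, hx, hy]
  | tmul f s =>
    simp only [oneTensor_apply, coRight_tmul, Algebra.TensorProduct.tmul_mul_tmul, _root_.one_mul,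
      LinearMap.lTensor_tmul, hD.mulAct_mulAct_right]

/-- For `T = Φ⁻¹` the tensor is one side of the inverse pentagon; `crossedMulMap_legAct_lTensor`
with `T = 1`, `S = Φ⁻¹` gives the other. -/
theorem ext₂_smashσ_lTensor (b b' b'' : B) (T : H ⊗[k] (H ⊗[k] H)) :
    ext₂ (D.smashσ Q) ((D.mulAct b b').lTensor H T ⊗ₜ b'') =
      (D.mulAct₃ b b' b'').lTensor H (tensorOne₃ T *
        coRight (coLeft H Q.Δ) (↑Q.Φ⁻¹ : H ⊗[k] (H ⊗[k] H)) *
        oneTensor (↑Q.Φ⁻¹ : H ⊗[k] (H ⊗[k] H))) := by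
  induction T with
  | zero => simp
  | add x y hx hy => simp only [TensorProduct.add_tmul, map_add, add_mul, hx, hy]
  | tmul f t =>
    rw [LinearMap.lTensor_tmul, ext₂_tmul, smashσ_tmul, hD.lTensor_mulAct_mulAct_left,
      mulId_lTensor, ← mul_assoc, ← mul_assoc, oneTensor_apply,
      Algebra.TensorProduct.tmul_mul_tmul, _root_.mul_one, _root_.one_mul]
    rfl

theorem crossedMulMap_legAct_lTensor (b b' b'' : B) (T : H ⊗[k] H) (S : H ⊗[k] (H ⊗[k] H)) :
    crossedMulMap (D.smashR Q) (D.smashσ Q)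
        (D.legAct T b ⊗ₜ (D.mulAct b' b'').lTensor H S) =
      (D.mulAct₃ b b' b'').lTensor H (tensorOne (H ⊗[k] H) T * coLeft (H ⊗[k] H) Q.Δ S *
        coRight (coRight Q.Δ) (↑Q.Φ⁻¹ : H ⊗[k] (H ⊗[k] H))) := by
  induction S with
  | zero => simp
  | add x y hx hy => simp only [TensorProduct.tmul_add, map_add, mul_add, add_mul, hx, hy]
  | tmul g t =>
    rw [LinearMap.lTensor_tmul, crossedMulMap_tmul, ext₂_smashR, hD.ext₁_legAct,
      hD.ext₂_smashσ_legAct, hD.lTensor_mulAct_mulAct_right, coLeft_eq_mul, map_mul (coRight _),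
      coRight_coRight_tensorOne₂, ← mul_assoc, ← mul_assoc, ← tensorOne, ← map_mul,
      tensorOne, (commute_coRight_oneTensor _ t).eq]

theorem legAct_one_left (T : H ⊗[k] H) :
    D.legAct T D.one = counitRightHom k H Q.ε T ⊗ₜ D.one := by
  induction T with
  | zero => simp [legAct_zero]
  | add x y hx hy => simp only [legAct_add, map_add, TensorProduct.add_tmul, hx, hy]
  | tmul g h => simp [legAct_tmul, hD.one_act, counitRightHom_tmul, TensorProduct.smul_tmul]

theorem lTensor_mulAct_one_left (b : B) (T : H ⊗[k] (H ⊗[k] H)) :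
    (D.mulAct D.one b).lTensor H T = D.legAct (coRight (counitLeftHom Q.ε) T) b := by
  induction T with
  | zero => simp [legAct_zero]
  | add x y hx hy => simp only [legAct_add, map_add, hx, hy]
  | tmul g t => rw [LinearMap.lTensor_tmul, hD.mulAct_one_left, coRight_tmul, legAct_tmul]

theorem lTensor_mulAct_one_right (b : B) (T : H ⊗[k] (H ⊗[k] H)) :
    (D.mulAct b D.one).lTensor H T = D.legAct (coRight (counitRightHom k H Q.ε) T) b := by
  induction T with
  | zero => simp [legAct_zero]
  | add x y hx hy => simp only [legAct_add, map_add, hx, hy]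
  | tmul g t => rw [LinearMap.lTensor_tmul, hD.mulAct_one_right, coRight_tmul, legAct_tmul]

theorem legAct_one (b : B) : D.legAct 1 b = 1 ⊗ₜ b := hD.legAct_tmul_one 1 b

theorem isCrossedProduct (hQ : Q.IsQuasiBialgebra) :
    IsCrossedProduct D.one (D.smashR Q) (D.smashσ Q) where
  R_one_left a := by rw [smashR_tmul, hD.legAct_one_left, hQ.counitRightHom_Δ]
  R_one_right b := by rw [smashR_tmul, map_one, hD.legAct_one]
  σ_one_left b := by
    rw [smashσ_tmul, hD.lTensor_mulAct_one_left, hQ.coRight_counitLeftHom_Φ_inv, hD.legAct_one]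
  σ_one_right b := by
    rw [smashσ_tmul, hD.lTensor_mulAct_one_right, hQ.coRight_counitRightHom_Φ_inv, hD.legAct_one]
  R_mul := by
    refine TensorProduct.ext_threefold' fun b h h' => ?_
    change D.smashR Q (b ⊗ₜ (h * h')) = ext₂ (D.smashR Q) (D.smashR Q (b ⊗ₜ h) ⊗ₜ h')
    rw [ext₂_smashR, smashR_tmul, smashR_tmul, hD.ext₁_legAct, map_mul]
  σ_cocycle := by
    refine TensorProduct.ext_threefold' fun b b' b'' => ?_
    change ext₂ (D.smashσ Q) ((D.smashR Q).rTensor B ((TensorProduct.assoc k B H B).symm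
      (b ⊗ₜ D.smashσ Q (b' ⊗ₜ b'')))) = ext₂ (D.smashσ Q) (D.smashσ Q (b ⊗ₜ b') ⊗ₜ b'')
    rw [ext₂_rTensor_assoc_symm, smashσ_tmul, smashσ_tmul, hD.ext₂_smashσ_lTensor,
      ← hD.legAct_one, hD.crossedMulMap_legAct_lTensor, map_one, _root_.one_mul, hQ.inv_pentagon]
  twisted_module := by
    refine TensorProduct.ext_threefold' fun b b' h => ?_
    change ext₂ (D.smashσ Q) ((D.smashR Q).rTensor B ((TensorProduct.assoc k B H B).symm
      (b ⊗ₜ D.smashR Q (b' ⊗ₜ h)))) = ext₂ (D.smashR Q) (D.smashσ Q (b ⊗ₜ b') ⊗ₜ h)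
    rw [ext₂_rTensor_assoc_symm, smashσ_tmul, smashR_tmul, ext₂_smashR, hD.ext₁_legAct_lTensor,
      ← hD.legAct_one, hD.crossedMulMap_legAct, map_one, _root_.one_mul, hQ.inv_quasi_coassoc]

theorem smashMul_eq_crossedMul : D.smashMul Q = crossedMul (D.smashR Q) (D.smashσ Q) := by
  refine TensorProduct.ext' fun h b => TensorProduct.ext' fun h' b' => ?_
  change _ = crossedMulMap _ _ (_ ⊗ₜ _)
  rw [smashMul_tmul, crossedMulMap_tmul, ext₂_smashR, ← hD.legAct_tmul_one, hD.ext₁_legAct,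
    hD.ext₂_smashσ_legAct, map_mul tensorOne₂,
    tensorOne₂_tmul]
  rfl

theorem smashMul_apply (x y : H ⊗[k] B) :
    D.smashMul Q x y = crossedMulMap (D.smashR Q) (D.smashσ Q) (x ⊗ₜ y) := by
  rw [hD.smashMul_eq_crossedMul]; rfl

theorem smashMul_legAct (b b' : B) (T S : H ⊗[k] H) :
    D.smashMul Q (D.legAct T b) (D.legAct S b') = (D.mulAct b b').lTensor H
        (tensorOne₂ T * coLeft H Q.Δ S * (↑Q.Φ⁻¹ : H ⊗[k] (H ⊗[k] H))) := by
  rw [hD.smashMul_apply, hD.crossedMulMap_legAct]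

theorem smashMul_assoc (hQ : Q.IsQuasiBialgebra) (x y z : H ⊗[k] B) :
    D.smashMul Q (D.smashMul Q x y) z = D.smashMul Q x (D.smashMul Q y z) := by
  induction x with
  | zero => simp
  | add x y hx hy => simp only [map_add, LinearMap.add_apply, hx, hy]
  | tmul h b =>
    induction y with
    | zero => simp
    | add x y hx hy => simp only [map_add, LinearMap.add_apply, hx, hy]
    | tmul h' b' =>
      induction z with
      | zero => simp
      | add x y hx hy => simp only [map_add, hx, hy]
      | tmul h'' b'' =>
        -- Writing `h ⊗ b` as `legAct (h ⊗ 1) b` brings both bracketings into the form of one tensor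
        -- in `H^{⊗4}`.
        rw [← hD.legAct_tmul_one h, ← hD.legAct_tmul_one h', hD.smashMul_legAct,
          hD.smashMul_apply, crossedMulMap_tmul, ext₂_smashR, hD.ext₁_legAct_lTensor,
          hD.ext₂_smashσ_lTensor, ← hD.legAct_tmul_one h'', hD.smashMul_legAct,
          hD.smashMul_apply, hD.crossedMulMap_legAct_lTensor]
        have e : coLeft H Q.Δ (h'' ⊗ₜ 1) = tensorOne₂ (Q.Δ h'') := by
          rw [coLeft_tmul, tensorOne₂_eq]
        congr 1
        simp only [map_mul, mul_assoc, hQ.inv_pentagon, e, coLeft_tensorOne₂,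
          ← tensorOne₃_tensorOne₂]
        -- After the pentagon, the sides differ only in the iterated coproduct of `h''`, which is
        -- moved past `Φ⁻¹ ⊗ 1`.
        rw [← mul_assoc (tensorOne₃ (coLeft H Q.Δ (Q.Δ h''))), ← map_mul tensorOne₃,
          hQ.inv_quasi_coassoc, map_mul, mul_assoc]

theorem isAlgebraStructure (hQ : Q.IsQuasiBialgebra) :
    IsAlgebraStructure (D.smashMul Q) ((1 : H) ⊗ₜ[k] D.one) where
  mul_assoc := hD.smashMul_assoc hQ
  one_mul x := by
    induction x with
    | zero => simp
    | add x y hx hy => simp only [map_add, hx, hy]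
    | tmul h b =>
      rw [← hD.legAct_tmul_one, ← hD.legAct_tmul_one, hD.smashMul_legAct,
        hD.lTensor_mulAct_one_left, ← Algebra.TensorProduct.one_def, map_one, _root_.one_mul,
        map_mul, hQ.coRight_counitLeftHom_coLeft, hQ.coRight_counitLeftHom_Φ_inv, _root_.mul_one]
  mul_one x := by
    induction x with
    | zero => simp
    | add x y hx hy => simp only [map_add, LinearMap.add_apply, hx, hy]
    | tmul h b =>
      rw [← hD.legAct_tmul_one, ← hD.legAct_tmul_one, hD.smashMul_legAct,
        hD.lTensor_mulAct_one_right, ← Algebra.TensorProduct.one_def, map_one, _root_.mul_one,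
        map_mul, hQ.coRight_counitRightHom_Φ_inv, _root_.mul_one, tensorOne₂_tmul, coRight_tmul,
        counitRightHom_tmul, map_one, one_smul]

end IsModuleAlgebra
end ModuleAlgebraData
end QuasiSmash
end

noncomputable section

set_option maxSynthPendingDepth 6

namespace QuasiSmash

/-! ### Invariance under twisting and the isomorphism. -/

section Twisting


namespace ModuleAlgebraData.IsModuleAlgebra

open QuasiBialgebraData

variable {k H B : Type*} [Field k] [Ring H] [Algebra k H] [AddCommGroup B] [Module k B]
  {Q : QuasiBialgebraData k H} {D : ModuleAlgebraData k H B} {F : (H ⊗[k] H)ˣ}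

theorem twist_lTensor_mulAct (hD : D.IsModuleAlgebra Q) (b b' : B) (T : H ⊗[k] (H ⊗[k] H)) :
    ((D.twist (F : H ⊗[k] H)).mulAct b b').lTensor H T =
      (D.mulAct b b').lTensor H (T * oneTensor (F : H ⊗[k] H)) := by
  induction T with
  | zero => simp
  | add x y hx hy => simp only [map_add, add_mul, hx, hy]
  | tmul f t =>
    rw [LinearMap.lTensor_tmul, hD.twist_mulAct, oneTensor_apply,
      Algebra.TensorProduct.tmul_mul_tmul, _root_.mul_one, LinearMap.lTensor_tmul]

theorem twistedR_eq (hD : D.IsModuleAlgebra Q) :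
    twistedR (D.smashR Q) (D.legAct F) (D.legAct (F⁻¹ : (H ⊗[k] H)ˣ)) =
      (D.twist F).smashR (Q.twist F) := by
  refine TensorProduct.ext' fun b h => ?_
  change ext₁ _ (ext₂ (D.smashR Q) (D.legAct F b ⊗ₜ h)) = D.legAct ((Q.twist F).Δ h) b
  rw [ext₂_smashR, hD.ext₁_legAct, hD.ext₁_legAct, twist_Δ]

theorem twistedσ_eq (hD : D.IsModuleAlgebra Q) :
    twistedσ (D.smashR Q) (D.smashσ Q) (D.legAct F) (D.legAct (F⁻¹ : (H ⊗[k] H)ˣ)) =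
      (D.twist F).smashσ (Q.twist F) := by
  refine TensorProduct.ext' fun b b' => ?_
  change ext₁ _ (crossedMulMap (D.smashR Q) (D.smashσ Q) (D.legAct F b ⊗ₜ D.legAct F b')) = _
  rw [hD.crossedMulMap_legAct, hD.ext₁_legAct_lTensor, smashσ_tmul, hD.twist_lTensor_mulAct,
    twist_Φ_inv]
  simp only [mul_assoc, map_units_inv_mul, _root_.mul_one]

/-- The `F⁻¹` of `γ` cancels the leading `F ⊗ 1` of `Φ_F⁻¹`, and the twisted product cancels its
trailing `1 ⊗ F⁻¹`. At `S = F⁻¹` the first two factors also cancel, leaving the tensor of `ext₁ γ ∘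
σ`; a general `S` allows reduction to pure tensors. -/
theorem ext₂_smashσ_twist (hD : D.IsModuleAlgebra Q) (hF : Q.IsGauge F) (b b' : B)
    (S : H ⊗[k] H) :
    ext₂ ((D.twist F).smashσ (Q.twist F))
        ((ext₁ (D.legAct (F⁻¹ : (H ⊗[k] H)ˣ)) ∘ₗ D.smashR Q).rTensor B
          ((TensorProduct.assoc k B H B).symm (b ⊗ₜ D.legAct S b'))) =
      (D.mulAct b b').lTensor H (coLeft H Q.Δ S * coLeft H Q.Δ (F : H ⊗[k] H) *
        (↑Q.Φ⁻¹ : H ⊗[k] (H ⊗[k] H)) * coRight Q.Δ (↑F⁻¹ : H ⊗[k] H)) := by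
  induction S with
  | zero => simp [legAct_zero]
  | add x y hx hy =>
    simp only [legAct_add, TensorProduct.tmul_add, map_add, add_mul, hx, hy]
  | tmul g h =>
    rw [legAct_tmul]
    change ext₂ _ (ext₁ _ (D.legAct (Q.Δ g) b) ⊗ₜ D.act b' h) = _
    rw [hD.ext₁_legAct]
    -- `legAct` depends only on the action, which twisting does not change, so the lemmas for the
    -- twisted data apply.
    change ext₂ _ ((D.twist (F : H ⊗[k] H)).legAct _ b ⊗ₜ _) = _
    rw [(hD.twist hF).ext₂_smashσ_legAct, hD.twist_lTensor_mulAct, hD.lTensor_mulAct_act_right,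
      twist_Φ_inv, coLeft_eq_mul, (commute_coRight_oneTensor _ h).eq, map_mul tensorOne₂]
    simp only [mul_assoc, map_units_inv_mul, map_units_inv_mul_cancel, _root_.mul_one]
    rfl

theorem isTwistingPair (hD : D.IsModuleAlgebra Q) (hF : Q.IsGauge F) :
    IsTwistingPair D.one (D.smashR Q) (D.smashσ Q)
      (D.legAct F) (D.legAct (F⁻¹ : (H ⊗[k] H)ˣ)) where
  θ_one := by rw [hD.legAct_one_left, hF.counitRightHom]
  γ_one := by rw [hD.legAct_one_left, hF.inv.counitRightHom]
  ext_γ_θ b := by rw [hD.ext₁_legAct, Units.mul_inv, hD.legAct_one]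
  ext_θ_γ b := by rw [hD.ext₁_legAct, Units.inv_mul, hD.legAct_one]
  compat := by
    rw [hD.twistedσ_eq]
    refine TensorProduct.ext' fun b b' => ?_
    refine (hD.ext₂_smashσ_twist hF b b' _).trans ?_
    rw [map_units_inv_mul, _root_.one_mul, LinearMap.comp_apply, smashσ_tmul,
      hD.ext₁_legAct_lTensor]

/-- Left `H`-linear extension of `b ↦ F¹ ⊗ b · F²`, which is invertible. -/
def twistEquiv (hD : D.IsModuleAlgebra Q) (F : (H ⊗[k] H)ˣ) : H ⊗[k] B ≃ₗ[k] H ⊗[k] B :=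
  LinearEquiv.ofLinearMap (ext₁ (D.legAct F)) (ext₁ (D.legAct (F⁻¹ : (H ⊗[k] H)ˣ)))
    (LinearMap.ext fun x => by
      rw [LinearMap.comp_apply, hD.ext₁_legAct_comp, Units.inv_mul, hD.ext₁_legAct_one]; rfl)
    (LinearMap.ext fun x => by
      rw [LinearMap.comp_apply, hD.ext₁_legAct_comp, Units.mul_inv, hD.ext₁_legAct_one]; rfl)

/-- After cancellation, both sides have tensor `(h ⊗ 1 ⊗ 1)(F Δ(h') ⊗ 1)(Δ ⊗ id)(F) Φ⁻¹` on pure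
tensors. -/
theorem ext₁_legAct_smashMul (hD : D.IsModuleAlgebra Q) (x y : H ⊗[k] B) :
    ext₁ (D.legAct F) ((D.twist F).smashMul (Q.twist F) x y) =
      D.smashMul Q (ext₁ (D.legAct F) x) (ext₁ (D.legAct F) y) := by
  induction x with
  | zero => simp
  | add x y hx hy => simp only [map_add, LinearMap.add_apply, hx, hy]
  | tmul h b =>
    induction y with
    | zero => simp
    | add x y hx hy => simp only [map_add, hx, hy]
    | tmul h' b' =>
      rw [smashMul_tmul, hD.twist_lTensor_mulAct, hD.ext₁_legAct_lTensor,
        ← hD.legAct_tmul_one h, ← hD.legAct_tmul_one h', hD.ext₁_legAct, hD.ext₁_legAct,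
        hD.smashMul_legAct, twist_Φ_inv, twist_Δ]
      have e : coLeft H Q.Δ (h' ⊗ₜ 1) = tensorOne₂ (Q.Δ h') := by
        rw [coLeft_tmul, tensorOne₂_eq]
      simp only [map_mul tensorOne₂, map_mul (coLeft _ _), e, mul_assoc, map_units_inv_mul,
        map_units_inv_mul_cancel, _root_.mul_one]
      rfl

end ModuleAlgebraData.IsModuleAlgebra

end Twisting

end QuasiSmash
end

open QuasiSmash in
theorem proposition2p3 {k H B : Type*} [Field k] [Ring H] [Algebra k H]
    [AddCommGroup B] [Module k B]
    (Q : QuasiBialgebraData k H) (hQ : Q.IsQuasiBialgebra)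
    (F : (H ⊗[k] H)ˣ) (hF : Q.IsGauge F)
    (D : ModuleAlgebraData k H B) (hD : D.IsModuleAlgebra Q) :
    -- `H_F` is a quasi-bialgebra and `_F B` is a right `H_F`-module algebra
    (Q.twist F).IsQuasiBialgebra ∧
    (D.twist F).IsModuleAlgebra (Q.twist F) ∧
    -- `H # B` is the crossed product `H ⊗_{R, σ} B`
    IsCrossedProduct D.one (D.smashR Q) (D.smashσ Q) ∧
    D.smashMul Q = crossedMul (D.smashR Q) (D.smashσ Q) ∧
    -- `H_F # _F B` is the crossed product `H ⊗_{R_F, σ_F} B`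
    IsCrossedProduct D.one ((D.twist F).smashR (Q.twist F)) ((D.twist F).smashσ (Q.twist F)) ∧
    (D.twist F).smashMul (Q.twist F) =
      crossedMul ((D.twist F).smashR (Q.twist F)) ((D.twist F).smashσ (Q.twist F)) ∧
    -- `θ` and `γ` satisfy the hypotheses of invariance under twisting, and `R' = R_F`, `σ' = σ_F`
    IsTwistingPair D.one (D.smashR Q) (D.smashσ Q)
      (D.legAct F) (D.legAct (F⁻¹ : (H ⊗[k] H)ˣ)) ∧
    twistedR (D.smashR Q) (D.legAct F) (D.legAct (F⁻¹ : (H ⊗[k] H)ˣ)) =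
      (D.twist F).smashR (Q.twist F) ∧
    twistedσ (D.smashR Q) (D.smashσ Q) (D.legAct F) (D.legAct (F⁻¹ : (H ⊗[k] H)ˣ)) =
      (D.twist F).smashσ (Q.twist F) ∧
    -- both smash products are associative unital algebras, and they are isomorphic
    ∃ (hS : IsAlgebraStructure (D.smashMul Q) ((1 : H) ⊗ₜ[k] D.one))
      (hT : IsAlgebraStructure ((D.twist F).smashMul (Q.twist F)) ((1 : H) ⊗ₜ[k] D.one))
      (e : AlgebraOf hT ≃ₐ[k] AlgebraOf hS),
      (∀ (h : H) (b : B), e (AlgebraOf.of hT (h ⊗ₜ b)) =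
        AlgebraOf.of hS ((D.act b).lTensor H ((h ⊗ₜ[k] (1 : H)) * (F : H ⊗[k] H)))) ∧
      (∀ x : H ⊗[k] B, e (AlgebraOf.of hT x) = AlgebraOf.of hS (ext₁ (D.legAct F) x)) := by
  have hQF := hQ.twist hF
  have hDF := hD.twist hF
  have hS := hD.isAlgebraStructure hQ
  have hT : IsAlgebraStructure ((D.twist F).smashMul (Q.twist F)) ((1 : H) ⊗ₜ[k] D.one) :=
    hDF.isAlgebraStructure hQF
  refine ⟨hQF, hDF, hD.isCrossedProduct hQ, hD.smashMul_eq_crossedMul, hDF.isCrossedProduct hQF,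
    hDF.smashMul_eq_crossedMul, hD.isTwistingPair hF, hD.twistedR_eq, hD.twistedσ_eq, hS, hT, ?_⟩
  refine ⟨AlgEquiv.ofLinearEquiv
    ((AlgebraOf.of hT).symm ≪≫ₗ hD.twistEquiv F ≪≫ₗ AlgebraOf.of hS) ?_ ?_, fun h b => ?_,
    fun x => rfl⟩
  · change ext₁ (D.legAct F) ((1 : H) ⊗ₜ[k] D.one) = (1 : H) ⊗ₜ[k] D.one
    rw [← hD.legAct_one, hD.ext₁_legAct, one_mul, hD.legAct_one_left, hF.counitRightHom,
      hD.legAct_one]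
  · exact hD.ext₁_legAct_smashMul
  · change ext₁ (D.legAct F) (h ⊗ₜ b) = D.legAct _ b
    rw [← hD.legAct_tmul_one, hD.ext₁_legAct]
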